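/- **Theorem (Averaged quenched CLT for the 2-regular configuration model).** For $N\ge 1$ give each vertex $i\in[N]=\{1,\dots,N\}$ two half-edges, and let $Q_N$ be the law of the random multigraph $G_N$ (loops and multiple edges allowed) obtained from a uniformly random perfect matching of the $2N$ half-edges, each matched pair forming an edge. For $\beta\ge 0$ and $B\in\mathbb R$ let $$\mu_{G_N}(\sigma)=\frac{1}{Z_{G_N}(\beta,B)}\exp\Big[\beta\sum_{(i,j)\in E(G_N)}\sigma_i\sigma_j+B\sum_{i\in[N]}\sigma_i\Big],\qquad \sigma\in\{-1,1\}^N,$$ where edges are counted with multiplicity (a loop at $i$ counts once, with $\sigma_i\sigma_i=1$) and $Z_{G_N}(\beta,B)$ is the normalizing constant. Let $P_N(\sigma)=Q_N(\mu_{G_N}(\sigma))$ be the averaged quenched measure, and $S_N=\sum_{i\in[N]}\sigma_i$. Write $P_N(S_N)$ for the expectation of $S_N$ under $P_N$. Let $$\psi^{d=1}(\beta,B)=\log\lambda_+(\beta,B),\qquad \lambda_+(\beta,B)=e^{\beta}\Big[\cosh B+\sqrt{\sinh^2 B+e^{-4\beta}}\Big].$$ Let $(G_N)_{N\ge1}$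 be random multigraphs on a common probability space, $G_N$ having law $Q_N$, with arbitrary dependence between different $N$. Then for all $\beta\ge0$ and $B\in\mathbb R$: 1. $\psi^{d=1}(\beta,B)$ is the limit of $\frac1N\log Z_N$ for the one-dimensional Ising model on $N$ sites, with periodic as well as with free boundary conditions, and almost surely $\frac1N\log Z_{G_N}(\beta,B)\to\psi^{d=1}(\beta,B)$. 2. There is a number $\chi=\chi(\beta,B)>0$ such that almost surely $\mathrm{Var}_{\mu_{G_N}}\big(S_N/\sqrt N\big)\to\chi$, that is, $\chi$ is the limit of the random quenched susceptibilities, and such that $$\frac{S_N-P_N(S_N)}{\sqrt N}\ \xrightarrow{\ \mathcal D\ }\ \mathcal N(0,\chi)\qquad\text{with respect to }P_N,\ \text{as }N\to\infty .$$ Moreover, $\chi$ equals the susceptibility of the one-dimensional Ising model: $$\chi(\beta,B)=\frac{\partial^2}{\partial B^2}\psi^{d=1}(\beta,B)=\frac{\cosh(B)\,e^{-4\beta}}{\big(\sinh^2(B)+e^{-4\beta}\big)^{3/2}} .$$ -/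

import Mathlib

open MeasureTheory ProbabilityTheory Filter Topology

namespace IsingCM

noncomputable section

/-! ## The Ising model on a finite multigraph

A multigraph on the vertex set `Fin N` is given by its multiset of edges; loops `s(i, i)` and repeated
edges are allowed, and each edge is counted with its multiplicity. -/

/-- Spin configurations in `{-1, 1}^N`. -/
abbrev Config (N : ℕ) : Type := Fin N → ℤˣ

instance : DiscreteMeasurableSpace ℤˣ :=
  ⟨fun s => ⟨Units.val '' s, trivial, Set.preimage_image_eq s Units.val_injective⟩⟩

instance (N : ℕ) : DiscreteMeasurableSpace (Config N) := inferInstance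

/-- The real value of the spin at the vertex `i`. -/
def spin {N : ℕ} (σ : Config N) (i : Fin N) : ℝ := ((σ i : ℤ) : ℝ)

/-- The total spin `S_N`. -/
def totalSpin {N : ℕ} (σ : Config N) : ℝ := ∑ i, spin σ i

/-- The product `σ_i σ_j` over the two endpoints of the edge `s(i, j)`. -/
def edgeSpin {N : ℕ} (σ : Config N) : Sym2 (Fin N) → ℝ :=
  Sym2.lift ⟨fun i j => spin σ i * spin σ j, fun _ _ => mul_comm _ _⟩

/-- The Boltzmann weight `exp (β ∑_{(i,j) ∈ E} σ_i σ_j + B ∑_i σ_i)`. -/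
def weight {N : ℕ} (E : Multiset (Sym2 (Fin N))) (β B : ℝ) (σ : Config N) : ℝ :=
  Real.exp (β * (E.map (edgeSpin σ)).sum + B * totalSpin σ)

/-- The partition function. -/
def partitionFn {N : ℕ} (E : Multiset (Sym2 (Fin N))) (β B : ℝ) : ℝ :=
  ∑ σ : Config N, weight E β B σ

/-- The Boltzmann–Gibbs probability of a configuration. -/
def gibbsProb {N : ℕ} (E : Multiset (Sym2 (Fin N))) (β B : ℝ) (σ : Config N) : ℝ :=
  weight E β B σ / partitionFn E β B

/-- The Boltzmann–Gibbs measure. -/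
def gibbsMeasure {N : ℕ} (E : Multiset (Sym2 (Fin N))) (β B : ℝ) : Measure (Config N) :=
  ∑ σ : Config N, ENNReal.ofReal (gibbsProb E β B σ) • Measure.dirac σ

/-- The pressure `(1/N) log Z`. -/
def pressure {N : ℕ} (E : Multiset (Sym2 (Fin N))) (β B : ℝ) : ℝ :=
  Real.log (partitionFn E β B) / N

/-- The finite-volume susceptibility: the variance of `S_N / √N` under the Boltzmann–Gibbs
measure. -/
def susceptibility {N : ℕ} (E : Multiset (Sym2 (Fin N))) (β B : ℝ) : ℝ :=
  Var[fun σ : Config N => totalSpin σ / √(N : ℝ); gibbsMeasure E β B]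

/-! ## The configuration model -/

/-- The half-edges for the degree sequence `d`: vertex `i` carries `d i` of them. -/
abbrev HalfEdge {N : ℕ} (d : Fin N → ℕ) : Type := Σ i : Fin N, Fin (d i)

/-- The pairings of all half-edges, that is, the fixed-point-free involutions of the set of
half-edges. -/
def Pairing {N : ℕ} (d : Fin N → ℕ) : Type :=
  {π : HalfEdge d → HalfEdge d // ∀ h, π h ≠ h ∧ π (π h) = h}

instance {N : ℕ} (d : Fin N → ℕ) : Fintype (Pairing d) :=
  inferInstanceAs (Fintype {π : HalfEdge d → HalfEdge d // ∀ h, π h ≠ h ∧ π (π h) = h})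

instance {N : ℕ} (d : Fin N → ℕ) : MeasurableSpace (Pairing d) := ⊤

instance {N : ℕ} (d : Fin N → ℕ) : DiscreteMeasurableSpace (Pairing d) := ⟨fun _ => trivial⟩

/-- The law of the configuration model: a uniform pairing of the half-edges. -/
def cmLaw {N : ℕ} (d : Fin N → ℕ) : Measure (Pairing d) := uniformOn Set.univ

/-- The multigraph of a pairing: one edge for each pair `{h, π h}` of half-edges, joining the
vertices that carry `h` and `π h`. -/
def edges {N : ℕ} {d : Fin N → ℕ} (π : Pairing d) : Multiset (Sym2 (Fin N)) :=
  (Finset.univ.image fun h : HalfEdge d => s(h, π.1 h)).val.map (Sym2.map Sigma.fst)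

/-- The degree sequence of the 2-regular model `CM_N(2)`. -/
abbrev twoRegular (N : ℕ) : Fin N → ℕ := fun _ => 2

/-- The averaged quenched probability `P_N(σ) = Q_N(μ_{G_N}(σ))` of a configuration, for the
configuration model with degree sequence `d`. -/
def avgProb {N : ℕ} (d : Fin N → ℕ) (β B : ℝ) (σ : Config N) : ℝ :=
  ∫ π, gibbsProb (edges π) β B σ ∂(cmLaw d)

/-- The averaged quenched measure `P_N`. -/
def avgMeasure {N : ℕ} (d : Fin N → ℕ) (β B : ℝ) : Measure (Config N) :=
  ∑ σ : Config N, ENNReal.ofReal (avgProb d β B σ) • Measure.dirac σ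

/-! ## The one-dimensional Ising model -/

/-- The edges `(i, i + 1)` of the one-dimensional chain with periodic boundary condition
`σ_{N+1} = σ_1`. -/
def cycleEdges (N : ℕ) : Multiset (Sym2 (Fin N)) :=
  (Finset.univ : Finset (Fin N)).val.map fun i => s(i, finRotate N i)

/-- The edges `(i, i + 1)` of the one-dimensional chain with free boundary condition. -/
def pathEdges (N : ℕ) : Multiset (Sym2 (Fin N)) :=
  ((Finset.univ : Finset (Fin N)).filter fun i : Fin N => i.val + 1 < N).val.map
    fun i => s(i, finRotate N i)

/-- The larger eigenvalue of the transfer matrix. -/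
def lambdaPlus (β B : ℝ) : ℝ :=
  Real.exp β * (Real.cosh B + √(Real.sinh B ^ 2 + Real.exp (-4 * β)))

/-- The infinite-volume pressure of the one-dimensional Ising model. -/
def pressureOneDim (β B : ℝ) : ℝ := Real.log (lambdaPlus β B)

/-- The susceptibility of the one-dimensional Ising model: the second derivative of its pressure in
the external field. -/
def susceptibilityOneDim (β B : ℝ) : ℝ := iteratedDeriv 2 (fun b => pressureOneDim β b) B

/-! ## The measures above are probability measures -/

lemma weight_pos {N : ℕ} (E : Multiset (Sym2 (Fin N))) (β B : ℝ) (σ : Config N) :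
    0 < weight E β B σ := Real.exp_pos _

lemma partitionFn_pos {N : ℕ} (E : Multiset (Sym2 (Fin N))) (β B : ℝ) :
    0 < partitionFn E β B :=
  Finset.sum_pos (fun σ _ => weight_pos E β B σ) Finset.univ_nonempty

lemma gibbsProb_nonneg {N : ℕ} (E : Multiset (Sym2 (Fin N))) (β B : ℝ) (σ : Config N) :
    0 ≤ gibbsProb E β B σ :=
  div_nonneg (weight_pos E β B σ).le (partitionFn_pos E β B).le

lemma sum_gibbsProb {N : ℕ} (E : Multiset (Sym2 (Fin N))) (β B : ℝ) :
    ∑ σ, gibbsProb E β B σ = 1 := by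
  unfold gibbsProb
  rw [← Finset.sum_div]
  exact div_self (partitionFn_pos E β B).ne'

lemma isProbabilityMeasure_sum_dirac {N : ℕ} (p : Config N → ℝ) (h0 : ∀ σ, 0 ≤ p σ)
    (h1 : ∑ σ, p σ = 1) :
    IsProbabilityMeasure (∑ σ : Config N, ENNReal.ofReal (p σ) • Measure.dirac σ) := by
  constructor
  simp only [Measure.coe_finsetSum, Finset.sum_apply, Measure.smul_apply, measure_univ,
    smul_eq_mul, mul_one]
  rw [← ENNReal.ofReal_sum_of_nonneg fun σ _ => h0 σ, h1, ENNReal.ofReal_one]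

instance {N : ℕ} (E : Multiset (Sym2 (Fin N))) (β B : ℝ) :
    IsProbabilityMeasure (gibbsMeasure E β B) :=
  isProbabilityMeasure_sum_dirac _ (gibbsProb_nonneg E β B) (sum_gibbsProb E β B)

instance (N : ℕ) : Nonempty (Pairing (twoRegular N)) :=
  ⟨⟨fun h => ⟨h.1, 1 - h.2⟩, by
    rintro ⟨i, k⟩
    fin_cases k <;> simp [Sigma.ext_iff]⟩⟩

instance {N : ℕ} (d : Fin N → ℕ) [Nonempty (Pairing d)] : IsProbabilityMeasure (cmLaw d) :=
  instIsProbabilityMeasure_uniformOn_univ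

instance {N : ℕ} (d : Fin N → ℕ) [Nonempty (Pairing d)] (β B : ℝ) :
    IsProbabilityMeasure (avgMeasure d β B) :=
  isProbabilityMeasure_sum_dirac _
    (fun σ => integral_nonneg fun π => gibbsProb_nonneg (edges π) β B σ) (by
      unfold avgProb
      rw [← integral_finsetSum _ fun σ _ => Integrable.of_finite]
      simp [sum_gibbsProb])

end

end IsingCM

namespace IsingCM

/-! ## Unions of cycles and the transfer matrix -/

/-! A 2-regular multigraph is a disjoint union of cycles, and a cycle of length `k` has partition
function `tr T^k = λ₊^k + λ₋^k`, with `T` the one-dimensional transfer matrix. Hence `log Z = N log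
λ₊ + Σ log (1 + (λ₋/λ₊)^k)`, the sum running over the cycles. Since `|λ₋/λ₊| < 1` persists for
complex fields close to `B`, the correction is analytic there and bounded by a constant times the
number `K` of cycles (`exists_complexPartitionFn_eq_exp`). Cauchy's estimates bound its derivatives
in the same way, so that `log Z`, the mean and the variance of the total spin agree with `N` times
their one-dimensional values up to `O(K)`, uniformly over all graphs (`exists_gibbs_bounds`).

It remains to see that `K` is of order `log N`. Adding a vertex to a uniform pairing creates a loop
in one case out of `2N + 1` and lengthens an existing cycle otherwise, which gives `Q_N(3^K) = 2N +
1` (`exists_numCycles`). Markov's inequality and Borel–Cantelli then yield the almost sure limits,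
whatever the dependence between different `N`.

For the central limit theorem, put `s = t/√N`. The quenched characteristic function of `S_N` at `s`
is `exp (N (ψ(B + is) - ψ(B)) + D)` with `|D| ≤ C K |s|`. The first term does not depend on the
graph, and its Taylor expansion gives the drift and the Gaussian factor. The average of `exp D`
tends to 1, because `Q_N(3^(pK)) ≤ (2N + 1)^p` with `p` of order `1/√N`. The mean of `S_N` varies
between graphs only by `O(K)`, so the averaged measure has the same variance `χ` as the quenched
ones. -/

/-- The map `s` on vertices behaves like a permutation with `n` cycles as far as transfer matrices
are concerned: putting the matrix `T ^ m i` on the edge `(i, s i)`, the partition function is a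
product of `n` traces of powers of `T`. -/
def HasCycles {N : ℕ} (s : Fin N → Fin N) (n : ℕ) : Prop :=
  ∀ m : Fin N → ℕ, (∀ i, 0 < m i) → ∃ L : Multiset ℕ, L.card = n ∧ L.sum = ∑ i, m i ∧
    (∀ k ∈ L, 0 < k) ∧ ∀ T : Matrix ℤˣ ℤˣ ℂ,
      ∑ σ : Config N, ∏ i, (T ^ m i) (σ i) (σ (s i)) = (L.map fun k => (T ^ k).trace).prod

lemma sum_config_succ {N : ℕ} (F : Config (N + 1) → ℂ) :
    ∑ σ, F σ = ∑ σ : Config N, ∑ a : ℤˣ, F (Fin.cons a σ) := by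
  rw [← (Fin.consEquiv fun _ : Fin (N + 1) => ℤˣ).sum_comp, Fintype.sum_prod_type_right]
  rfl

/-- The map `s`, with a loop at a new vertex. -/
def addLoop {N : ℕ} (s : Fin N → Fin N) : Fin (N + 1) → Fin (N + 1) :=
  Fin.cons 0 fun x => (s x).succ

/-- The map `s`, with a new vertex inserted between `i` and `s i`. -/
def insertAfter {N : ℕ} (s : Fin N → Fin N) (i : Fin N) : Fin (N + 1) → Fin (N + 1) :=
  Fin.cons (s i).succ fun x => if x = i then 0 else (s x).succ

lemma hasCycles_zero (s : Fin 0 → Fin 0) : HasCycles s 0 := fun m _ =>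
  ⟨0, by simp⟩

/-- The spin at the new vertex decouples from the others, and summing over it gives the extra factor
`(T ^ m 0).trace`. -/
lemma HasCycles.addLoop {N n : ℕ} {s : Fin N → Fin N} (h : HasCycles s n) :
    HasCycles (addLoop s) (n + 1) := by
  intro m hm
  obtain ⟨L, hc, hs, hp, hT⟩ := h (fun i => m i.succ) fun i => hm _
  refine ⟨m 0 ::ₘ L, by simp [hc], by simp [hs, Fin.sum_univ_succ], ?_, fun T => ?_⟩
  · intro k hk
    rcases Multiset.mem_cons.1 hk with rfl | hk
    exacts [hm 0, hp k hk]
  · rw [sum_config_succ, Multiset.map_cons, Multiset.prod_cons, ← hT T, Finset.mul_sum]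
    refine Finset.sum_congr rfl fun σ _ => ?_
    simp only [Fin.prod_univ_succ, IsingCM.addLoop, Fin.cons_zero, Fin.cons_succ]
    rw [← Finset.sum_mul]
    rfl

/-- Summing over the new spin is a matrix product: it merges `T ^ m i` and `T ^ m 0` into one power
on the edge `(i, s i)`. Arbitrary exponents in `HasCycles` make this induction close. -/
lemma HasCycles.insertAfter {N n : ℕ} {s : Fin N → Fin N} (h : HasCycles s n) (i : Fin N) :
    HasCycles (insertAfter s i) n := by
  intro m hm
  obtain ⟨L, hc, hs, hp, hT⟩ := h (fun x => if x = i then m i.succ + m 0 else m x.succ)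
    fun x => by split_ifs; exacts [Nat.add_pos_left (hm _) _, hm _]
  refine ⟨L, hc, ?_, hp, fun T => ?_⟩
  · rw [hs, Fin.sum_univ_succ, ← Finset.add_sum_erase _ _ (Finset.mem_univ i),
      ← Finset.add_sum_erase _ (fun x : Fin N => m x.succ) (Finset.mem_univ i), if_pos rfl,
      Finset.sum_congr rfl fun x hx => if_neg (Finset.ne_of_mem_erase hx)]
    ring
  · rw [sum_config_succ, ← hT T]
    refine Finset.sum_congr rfl fun σ _ => ?_
    rw [← Finset.mul_prod_erase _ _ (Finset.mem_univ i), if_pos rfl, pow_add, Matrix.mul_apply,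
      Finset.sum_mul]
    refine Finset.sum_congr rfl fun a _ => ?_
    simp only [Fin.prod_univ_succ, IsingCM.insertAfter, Fin.cons_zero, Fin.cons_succ]
    rw [← Finset.mul_prod_erase _ _ (Finset.mem_univ i)]
    simp only [if_pos, Fin.cons_zero]
    have h1 : ∀ x ∈ Finset.univ.erase i,
        (T ^ m x.succ) (σ x) ((Fin.cons a σ : Config (N + 1)) (if x = i then 0 else (s x).succ)) =
          (T ^ if x = i then m i.succ + m 0 else m x.succ) (σ x) (σ (s x)) := fun x hx => by
      rw [if_neg (Finset.ne_of_mem_erase hx), if_neg (Finset.ne_of_mem_erase hx), Fin.cons_succ]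
    rw [Finset.prod_congr rfl h1]
    ring

/-- The new vertex `0` splits the closing edge from the last vertex back to the first. -/
lemma finRotate_eq_insertAfter (N : ℕ) :
    ⇑(finRotate (N + 2)) = insertAfter (finRotate (N + 1)) (Fin.last N) := by
  funext x
  refine Fin.cases ?_ (fun x => ?_) x
  · simp [insertAfter]
  · simp only [insertAfter, Fin.cons_succ]
    split_ifs with h
    · subst h
      simp
    · have : x.val < N := by
        have := Fin.val_lt_last h
        simpa using this
      rw [finRotate_of_lt (k := x.val) this]
      ext
      simp only [Fin.succ]
      rw [finRotate_of_lt (k := x.val + 1) (by omega)]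

lemma hasCycles_finRotate (N : ℕ) : HasCycles (finRotate (N + 1)) 1 := by
  induction N with
  | zero =>
    convert (hasCycles_zero id).addLoop
    ext x; simp
  | succ N ih =>
    rw [finRotate_eq_insertAfter]
    exact ih.insertAfter _

/-! ## Pairings of the half-edges of the 2-regular model -/

/-- `π` is a fixed-point-free involution. -/
def IsPairing {X : Type*} (π : X → X) : Prop := ∀ h, π h ≠ h ∧ π (π h) = h

/-- Extend `π` by two points: match them with each other, or break the pair of `h` and match them
with `h` and `π h`. -/
def insertPair {X : Type*} [DecidableEq X] (π : X → X) : Option X → Option (Option X) → Option (Option X)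
  | none, none => some none
  | none, some none => none
  | none, some (some x) => some (some (π x))
  | some h, none => some (some h)
  | some h, some none => some (some (π h))
  | some h, some (some x) =>
    if x = h then none else if x = π h then some none else some (some (π x))

section

variable {X : Type*} [DecidableEq X]

lemma IsPairing.insertPair {π : X → X} (hπ : IsPairing π) (o : Option X) :
    IsPairing (insertPair π o) := by
  intro y
  rcases o with _ | h <;> rcases y with _ | _ | x <;>
    simp only [IsingCM.insertPair, IsPairing] at * <;> grind [IsingCM.insertPair]

/-- The partner of `none` reveals `o`, so the two ends of a broken pair give different extensions;
rejoining the partners of the two new points recovers `π`. -/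
lemma insertPair_injective {π π' : X → X} (hπ : IsPairing π) (hπ' : IsPairing π')
    {o o' : Option X} (h : insertPair π o = insertPair π' o') : π = π' ∧ o = o' := by
  have h0 := congrFun h none
  have h1 := congrFun h (some none)
  have h2 : ∀ x, insertPair π o (some (some x)) = insertPair π' o' (some (some x)) :=
    fun x => congrFun h _
  rcases o with _ | a <;> rcases o' with _ | a' <;>
    simp only [insertPair, IsPairing] at * <;> grind

lemma exists_insertPair_eq {τ : Option (Option X) → Option (Option X)} (hτ : IsPairing τ) :
    ∃ π : X → X, IsPairing π ∧ ∃ o, insertPair π o = τ := by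
  rcases h0 : τ none with _ | _ | h
  · exact absurd h0 (hτ none).1
  · have : ∀ x, ∃ y, τ (some (some x)) = some (some y) := fun x => by
      rcases hx : τ (some (some x)) with _ | _ | y <;> grind [IsPairing]
    choose π hπ using this
    refine ⟨π, fun x => ?_, none, ?_⟩
    · grind [IsPairing]
    · funext y
      rcases y with _ | _ | y <;> simp only [insertPair] <;> grind [IsPairing]
  · obtain ⟨h', h1⟩ : ∃ h', τ (some none) = some (some h') := by
      rcases hx : τ (some none) with _ | _ | y <;> grind [IsPairing]
    -- `π` joins the two former partners `h` and `h'` of the new points and follows `τ` elsewhere.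
    have : ∀ x, ∃ y, (x = h ∧ y = h') ∨ (x = h' ∧ y = h) ∨
        (x ≠ h ∧ x ≠ h' ∧ τ (some (some x)) = some (some y)) := fun x => by
      rcases hx : τ (some (some x)) with _ | _ | y <;> grind [IsPairing]
    choose π hπ using this
    have e0 := hτ none
    have e1 := hτ (some none)
    have hne : h ≠ h' := by grind [IsPairing]
    have hh : π h = h' := by grind
    refine ⟨π, fun x => ?_, some h, ?_⟩
    · have e2 := hτ (some (some x))
      grind
    · funext y
      rcases y with _ | _ | y <;> simp only [insertPair] <;> grind [IsPairing]

end

/-- The half-edges of `N + 1` vertices: those of the new vertex `0`, and the old ones. -/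
def halfEdgeSuccEquiv (N : ℕ) :
    HalfEdge (twoRegular (N + 1)) ≃ Option (Option (HalfEdge (twoRegular N))) where
  toFun h := Fin.cases (motive := fun _ => Fin 2 → Option (Option (HalfEdge (twoRegular N))))
    (fun k => if k = 0 then none else some none) (fun i k => some (some ⟨i, k⟩)) h.1 h.2
  invFun
    | none => ⟨0, (0 : Fin 2)⟩
    | some none => ⟨0, (1 : Fin 2)⟩
    | some (some h) => ⟨h.1.succ, h.2⟩
  left_inv := by
    rintro ⟨i, k⟩
    induction i using Fin.cases with
    | zero => fin_cases k <;> rfl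
    | succ i => rfl
  right_inv := by
    rintro (_ | _ | h) <;> rfl

/-- Pairings of `N + 1` vertices are obtained from those of `N` vertices by giving the new vertex a
loop or by inserting it into an edge. -/
def extendPairing (N : ℕ)
    (p : Pairing (twoRegular N) × Option (HalfEdge (twoRegular N))) : Pairing (twoRegular (N + 1)) :=
  ⟨fun h => (halfEdgeSuccEquiv N).symm (insertPair p.1.1 p.2 (halfEdgeSuccEquiv N h)), fun h => by
    have := IsPairing.insertPair p.1.2 p.2 (halfEdgeSuccEquiv N h)
    refine ⟨fun hh => this.1 ?_, ?_⟩
    · rwa [Equiv.symm_apply_eq] at hh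
    · simp only [Equiv.apply_symm_apply]
      rw [this.2, Equiv.symm_apply_apply]⟩

lemma extendPairing_bijective (N : ℕ) : Function.Bijective (extendPairing N) := by
  constructor
  · rintro ⟨⟨π, hπ⟩, o⟩ ⟨⟨π', hπ'⟩, o'⟩ h
    have h1 : insertPair π o = insertPair π' o' := by
      funext y
      have := congrFun (congrArg Subtype.val h) ((halfEdgeSuccEquiv N).symm y)
      simpa [extendPairing] using this
    obtain ⟨rfl, rfl⟩ := insertPair_injective hπ hπ' h1
    rfl
  · rintro ⟨τ, hτ⟩
    obtain ⟨π, hπ, o, ho⟩ := exists_insertPair_eq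
      (τ := fun y => halfEdgeSuccEquiv N (τ ((halfEdgeSuccEquiv N).symm y))) (fun y => by
        refine ⟨fun h => (hτ ((halfEdgeSuccEquiv N).symm y)).1 ?_, ?_⟩
        · rw [Equiv.eq_symm_apply]
          exact h
        · simp [(hτ _).2])
    refine ⟨(⟨π, hπ⟩, o), Subtype.ext ?_⟩
    funext h
    simp [extendPairing, ho]

/-! ### Edges of an extended pairing -/

/-- Each pair is met from both of its ends. Doubling replaces the image in `edges` by a sum over
half-edges, which splits when a vertex is added; `two_nsmul_injective` removes the factor
afterwards. -/
lemma two_nsmul_edges {N : ℕ} {d : Fin N → ℕ} (π : Pairing d) :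
    2 • edges π = ∑ h : HalfEdge d, {s(h.1, (π.1 h).1)} := by
  have h1 := Finset.sum_comp (s := Finset.univ)
    (fun e : Sym2 (HalfEdge d) => ({Sym2.map Sigma.fst e} : Multiset (Sym2 (Fin N))))
    (fun h : HalfEdge d => s(h, π.1 h))
  simp only [Sym2.map_mk] at h1
  refine Eq.trans ?_ h1.symm
  have h2 : ∀ e ∈ Finset.univ.image (fun h : HalfEdge d => s(h, π.1 h)),
      (Finset.univ.filter fun h : HalfEdge d => s(h, π.1 h) = e).card = 2 := by
    intro e he
    obtain ⟨x, -, rfl⟩ := Finset.mem_image.1 he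
    rw [Finset.card_eq_two]
    refine ⟨x, π.1 x, (π.2 x).1.symm, ?_⟩
    ext y
    have := π.2 x
    have := π.2 y
    simp only [Finset.mem_filter, Finset.mem_univ, true_and, Sym2.eq_iff, Finset.mem_insert,
      Finset.mem_singleton]
    grind
  rw [Finset.sum_congr rfl fun e he => by rw [h2 e he], ← Finset.smul_sum]
  congr 1
  rw [edges, ← Multiset.sum_map_singleton (Multiset.map _ _), Multiset.map_map]
  rfl

lemma two_nsmul_injective {α : Type*} {A B : Multiset α} (h : 2 • A = 2 • B) : A = B := by
  classical
  ext a
  have := congrArg (Multiset.count a) h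
  simpa [Multiset.count_nsmul] using this

lemma sum_halfEdge_succ {N : ℕ} {M : Type*} [AddCommMonoid M]
    (f : HalfEdge (twoRegular (N + 1)) → M) :
    ∑ h, f h = f ((halfEdgeSuccEquiv N).symm none) + (f ((halfEdgeSuccEquiv N).symm (some none)) +
      ∑ h, f ((halfEdgeSuccEquiv N).symm (some (some h)))) := by
  rw [← (halfEdgeSuccEquiv N).symm.sum_comp, Fintype.sum_option, Fintype.sum_option]

lemma edges_extendPairing_none {N : ℕ} (π : Pairing (twoRegular N)) :
    edges (extendPairing N (π, none)) = s(0, 0) ::ₘ (edges π).map (Sym2.map Fin.succ) := by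
  apply two_nsmul_injective
  rw [two_nsmul_edges, sum_halfEdge_succ, ← Multiset.singleton_add, nsmul_add,
    ← Multiset.coe_mapAddMonoidHom, ← map_nsmul, two_nsmul_edges, map_sum, ← add_assoc, two_nsmul]
  simp [extendPairing, insertPair]
  rfl

lemma edges_extendPairing_some {N : ℕ} (π : Pairing (twoRegular N)) (h : HalfEdge (twoRegular N))
    {E : Multiset (Sym2 (Fin N))} (hE : edges π = s(h.1, (π.1 h).1) ::ₘ E) :
    edges (extendPairing N (π, some h)) =
      s(h.1.succ, 0) ::ₘ s(0, (π.1 h).1.succ) ::ₘ E.map (Sym2.map Fin.succ) := by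
  have hne : π.1 h ≠ h := (π.2 h).1
  have hmem : π.1 h ∈ Finset.univ.erase h := Finset.mem_erase.2 ⟨hne, Finset.mem_univ _⟩
  set R := (Finset.univ.erase h).erase (π.1 h) with hR
  -- The terms of `h` and `π h` are the two copies of the broken edge, and they cancel.
  have hE2 : 2 • E = ∑ x ∈ R, {s(x.1, (π.1 x).1)} := by
    have h1 := two_nsmul_edges π
    rw [hE, ← Multiset.singleton_add, nsmul_add,
      ← Finset.add_sum_erase _ _ (Finset.mem_univ h), ← Finset.add_sum_erase _ _ hmem, (π.2 h).2,
      Sym2.eq_swap (a := (π.1 h).1), ← add_assoc, two_nsmul] at h1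
    exact add_left_cancel h1
  apply two_nsmul_injective
  rw [two_nsmul_edges, sum_halfEdge_succ, ← Multiset.singleton_add, ← Multiset.singleton_add,
    nsmul_add, nsmul_add, ← Multiset.coe_mapAddMonoidHom, ← map_nsmul, hE2, map_sum,
    ← Finset.add_sum_erase _ _ (Finset.mem_univ h), ← Finset.add_sum_erase _ _ hmem]
  have h2 : ∀ x ∈ R, (extendPairing N (π, some h)).1 ((halfEdgeSuccEquiv N).symm (some (some x))) =
      (halfEdgeSuccEquiv N).symm (some (some (π.1 x))) := fun x hx => by
    have h3 : x ≠ π.1 h := Finset.ne_of_mem_erase hx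
    have h4 : x ≠ h := Finset.ne_of_mem_erase (Finset.mem_of_mem_erase hx)
    simp [extendPairing, insertPair, h3, h4]
  rw [Finset.sum_congr rfl fun x hx => by rw [h2 x hx]]
  simp only [extendPairing, insertPair, Equiv.apply_symm_apply, if_pos, if_neg hne, two_nsmul]
  simp only [halfEdgeSuccEquiv, Equiv.coe_fn_symm_mk, Multiset.coe_mapAddMonoidHom,
    Multiset.map_singleton, Sym2.map_mk]
  rw [Sym2.eq_swap (a := 0) (b := h.1.succ), Sym2.eq_swap (b := 0) (a := (π.1 h).1.succ)]
  abel

/-- The multigraph of `s : Fin N → Fin N`, which has an edge between `i` and `s i` for each `i`. -/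
def mapEdges {N : ℕ} (s : Fin N → Fin N) : Multiset (Sym2 (Fin N)) :=
  (Finset.univ : Finset (Fin N)).val.map fun i => s(i, s i)

lemma fin_univ_val_succ (N : ℕ) : (Finset.univ : Finset (Fin (N + 1))).val =
    0 ::ₘ (Finset.univ : Finset (Fin N)).val.map Fin.succ := by
  rw [Fin.univ_succ]
  simp

lemma mapEdges_addLoop {N : ℕ} (s : Fin N → Fin N) :
    mapEdges (addLoop s) = s(0, 0) ::ₘ (mapEdges s).map (Sym2.map Fin.succ) := by
  rw [mapEdges, mapEdges, fin_univ_val_succ, Multiset.map_cons, Multiset.map_map, Multiset.map_map]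
  simp [addLoop, Function.comp_def]

lemma mapEdges_insertAfter {N : ℕ} (s : Fin N → Fin N) (i : Fin N) :
    mapEdges (insertAfter s i) = s(i.succ, 0) ::ₘ s(0, (s i).succ) ::ₘ
      ((Finset.univ.erase i).val.map fun i => s(i, s i)).map (Sym2.map Fin.succ) := by
  rw [mapEdges, fin_univ_val_succ, Multiset.map_cons, Multiset.map_map,
    ← Finset.insert_erase (Finset.mem_univ i), Finset.insert_val_of_notMem (by simp),
    Multiset.map_cons, Multiset.cons_swap, Finset.insert_erase (Finset.mem_univ i)]
  simp only [insertAfter, Fin.cons_zero, Function.comp, Fin.cons_succ, if_true, Multiset.map_map,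
    Sym2.map_mk]
  congr 2
  refine Multiset.map_congr rfl fun x hx => ?_
  rw [if_neg (Finset.ne_of_mem_erase (Finset.mem_def.2 hx))]
  rfl

/-- The multigraph `E` is a union of `n` cycles. -/
def IsCycleUnion {N : ℕ} (E : Multiset (Sym2 (Fin N))) (n : ℕ) : Prop :=
  ∃ s : Fin N → Fin N, E = mapEdges s ∧ HasCycles s n

lemma IsCycleUnion.extendPairing_none {N n : ℕ} {π : Pairing (twoRegular N)}
    (h : IsCycleUnion (edges π) n) : IsCycleUnion (edges (extendPairing N (π, none))) (n + 1) := by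
  obtain ⟨s, hs, hc⟩ := h
  exact ⟨addLoop s, by rw [edges_extendPairing_none, mapEdges_addLoop, hs], hc.addLoop⟩

lemma IsCycleUnion.extendPairing_some {N n : ℕ} {π : Pairing (twoRegular N)}
    (h : IsCycleUnion (edges π) n) (x : HalfEdge (twoRegular N)) :
    IsCycleUnion (edges (extendPairing N (π, some x))) n := by
  obtain ⟨s, hs, hc⟩ := h
  have hx : s(x.1, (π.1 x).1) ∈ edges π :=
    Multiset.mem_map.2 ⟨s(x, π.1 x), Finset.mem_def.1 (Finset.mem_image_of_mem (fun h => s(h, π.1 h)) (Finset.mem_univ x)), rfl⟩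
  -- The broken edge is some `{i, s i}`, so the new vertex goes after `i`.
  obtain ⟨i, -, hi⟩ := Multiset.mem_map.1 (hs ▸ hx)
  have hE : edges π = s(i, s i) ::ₘ (Finset.univ.erase i).val.map fun i => s(i, s i) := by
    rw [hs, mapEdges, ← Finset.insert_erase (Finset.mem_univ i),
      Finset.insert_val_of_notMem (by simp), Multiset.map_cons, Finset.insert_erase (Finset.mem_univ i)]
  refine ⟨insertAfter s i, ?_, hc.insertAfter i⟩
  rw [edges_extendPairing_some π x (hi ▸ hE), mapEdges_insertAfter]
  -- The half-edge `x` may sit at either end of the edge as oriented by `s`; the undirected result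
  -- is the same.
  rcases Sym2.eq_iff.1 hi with ⟨h1, h2⟩ | ⟨h1, h2⟩
  · rw [← h1, ← h2]
  · rw [← h1, ← h2, Multiset.cons_swap, Sym2.eq_swap (a := i.succ), Sym2.eq_swap (a := (s i).succ)]

/-- The multigraph of the 2-regular configuration model is a union of cycles; the number of cycles
has the generating function of a sum of independent Bernoulli variables, evaluated here at `3`. -/
theorem exists_numCycles (N : ℕ) : ∃ K : Pairing (twoRegular N) → ℕ,
    (∀ π, IsCycleUnion (edges π) (K π)) ∧
      ∑ π, 3 ^ K π = (2 * N + 1) * Fintype.card (Pairing (twoRegular N)) := by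
  induction N with
  | zero =>
    refine ⟨fun _ => 0, fun π => ⟨id, ?_, hasCycles_zero _⟩, by simp⟩
    apply two_nsmul_injective
    rw [two_nsmul_edges]
    simp [mapEdges]
  | succ N ih =>
    obtain ⟨K, hK, hsum⟩ := ih
    let e := Equiv.ofBijective _ (extendPairing_bijective N)
    let K' : Pairing (twoRegular N) × Option (HalfEdge (twoRegular N)) → ℕ :=
      fun p => p.2.elim (K p.1 + 1) fun _ => K p.1
    have hX : Fintype.card (HalfEdge (twoRegular N)) = 2 * N := by
      simp [twoRegular, mul_comm]
    refine ⟨fun π => K' (e.symm π), fun π => ?_, ?_⟩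
    · obtain ⟨⟨π, o⟩, rfl⟩ := e.surjective π
      simp only [e.symm_apply_apply]
      rcases o with _ | x
      exacts [(hK π).extendPairing_none, (hK π).extendPairing_some x]
    -- One extension adds a cycle and `2N` do not, so the sum is multiplied by `3 + 2N` while the
    -- number of pairings is multiplied by `2N + 1`. At the value 3 the product of these ratios
    -- telescopes.
    · rw [← e.sum_comp, ← Fintype.card_congr e, Fintype.card_prod, Fintype.card_option, hX,
        Fintype.sum_prod_type]
      simp only [e.symm_apply_apply, Fintype.sum_option, K', Option.elim, Finset.sum_const,
        Finset.card_univ, hX, smul_eq_mul, pow_succ]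
      rw [Finset.sum_add_distrib, ← Finset.sum_mul, ← Finset.mul_sum, hsum]
      ring

/-! ## The partition function of a union of cycles -/

/-- The partition function with a complex external field. -/
noncomputable def complexPartitionFn {N : ℕ} (E : Multiset (Sym2 (Fin N))) (β : ℝ) (z : ℂ) : ℂ :=
  ∑ σ : Config N, Complex.exp ((β * (E.map (edgeSpin σ)).sum : ℝ) + z * totalSpin σ)

lemma complexPartitionFn_ofReal {N : ℕ} (E : Multiset (Sym2 (Fin N))) (β B : ℝ) :
    complexPartitionFn E β B = (partitionFn E β B : ℂ) := by
  simp only [complexPartitionFn, partitionFn, weight]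
  push_cast
  rfl

/-- The transfer matrix with a complex external field. -/
noncomputable def transfer (β : ℝ) (z : ℂ) : Matrix ℤˣ ℤˣ ℂ :=
  fun a b => Complex.exp (β * (((a : ℤ) : ℂ) * ((b : ℤ) : ℂ)) + z * ((a : ℤ) : ℂ))

/-- The field sits only on the row index of `transfer`. As each vertex starts exactly one edge `(i,
s i)`, its field is counted once. -/
lemma prod_transfer {N : ℕ} (s : Fin N → Fin N) (β : ℝ) (z : ℂ) (σ : Config N) :
    ∏ i, transfer β z (σ i) (σ (s i)) =
      Complex.exp ((β * ((mapEdges s).map (edgeSpin σ)).sum : ℝ) + z * totalSpin σ) := by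
  simp only [transfer, ← Complex.exp_sum, mapEdges, Multiset.map_map, totalSpin,
    Finset.sum_add_distrib, ← Finset.mul_sum]
  congr 2
  · push_cast
    congr 1
    change _ = ((∑ i, edgeSpin σ s(i, s i) : ℝ) : ℂ)
    push_cast
    refine Finset.sum_congr rfl fun i _ => ?_
    simp [edgeSpin, spin]
  · push_cast
    rfl

lemma sum_units_int (f : ℤˣ → ℂ) : ∑ a, f a = f 1 + f (-1) := by
  rw [UnitsInt.univ, Finset.sum_insert (by decide), Finset.sum_singleton]

/-- By Cayley–Hamilton for a 2×2 matrix, the traces satisfy the two-term recurrence of `x ^ k + y ^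
k`. No diagonalization is needed. -/
lemma trace_pow_of_units (T : Matrix ℤˣ ℤˣ ℂ) {x y : ℂ} (hadd : x + y = T 1 1 + T (-1) (-1))
    (hmul : x * y = T 1 1 * T (-1) (-1) - T 1 (-1) * T (-1) 1) (k : ℕ) :
    (T ^ k).trace = x ^ k + y ^ k := by
  have hsq : T ^ 2 = (x + y) • T - (x * y) • (1 : Matrix ℤˣ ℤˣ ℂ) := by
    ext a b
    rw [pow_two, Matrix.mul_apply, sum_units_int, Matrix.sub_apply, Matrix.smul_apply,
      Matrix.smul_apply, hadd, hmul]
    rcases Int.units_eq_one_or a with rfl | rfl <;> rcases Int.units_eq_one_or b with rfl | rfl <;>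
      simp <;> ring
  induction k using Nat.twoStepInduction with
  | zero => simp [Matrix.trace, one_add_one_eq_two]
  | one => simp [Matrix.trace, hadd]
  | more k h0 h1 =>
    rw [pow_add, hsq, mul_sub, Matrix.mul_smul, Matrix.mul_smul, mul_one, ← pow_succ,
      Matrix.trace_sub, Matrix.trace_smul, Matrix.trace_smul, h0, h1, smul_eq_mul, smul_eq_mul]
    ring

/-- The discriminant `sinh² z + e^{-4β}`. -/
noncomputable def disc (β : ℝ) (z : ℂ) : ℂ := Complex.sinh z ^ 2 + Real.exp (-4 * β)

/-- The square root of the discriminant. -/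
noncomputable def discRoot (β : ℝ) (z : ℂ) : ℂ := Complex.exp (Complex.log (disc β z) / 2)

/-- The larger eigenvalue of the transfer matrix. -/
noncomputable def eigenPlus (β : ℝ) (z : ℂ) : ℂ :=
  Real.exp β * (Complex.cosh z + discRoot β z)

/-- The smaller eigenvalue of the transfer matrix. -/
noncomputable def eigenMinus (β : ℝ) (z : ℂ) : ℂ :=
  Real.exp β * (Complex.cosh z - discRoot β z)

/-- At a zero of `disc` the convention `log 0 = 0` makes `discRoot` equal to 1, hence the
hypothesis. -/
lemma discRoot_sq {β : ℝ} {z : ℂ} (h : disc β z ≠ 0) : discRoot β z ^ 2 = disc β z := by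
  rw [discRoot, ← Complex.exp_nat_mul]
  push_cast
  rw [mul_div_cancel₀ _ two_ne_zero, Complex.exp_log h]

/-- The trace of `transfer` is `2 e^β cosh z`, and its determinant is `e^{2β} - e^{-2β} = e^{2β}
(cosh² z - disc)`. -/
lemma trace_transfer_pow {β : ℝ} {z : ℂ} (h : disc β z ≠ 0) (k : ℕ) :
    (transfer β z ^ k).trace = eigenPlus β z ^ k + eigenMinus β z ^ k := by
  apply trace_pow_of_units
  · simp only [eigenPlus, eigenMinus, transfer, Complex.cosh]
    simp [Complex.exp_add]
    ring
  · have h1 : eigenPlus β z * eigenMinus β z =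
        Real.exp β ^ 2 * (Complex.cosh z ^ 2 - discRoot β z ^ 2) := by
      rw [eigenPlus, eigenMinus]; ring
    rw [h1, discRoot_sq h, disc, Complex.cosh_sq]
    simp only [transfer, ← Complex.exp_add]
    have h2 : (Real.exp β ^ 2 * Real.exp (-4 * β) : ℝ) = Real.exp (- 2 * β) := by
      rw [← Real.exp_nat_mul, ← Real.exp_add]; congr 1; push_cast; ring
    have h3 : (Real.exp β ^ 2 : ℝ) = Real.exp (2 * β) := by
      rw [← Real.exp_nat_mul]; congr 1
    have h2' := congrArg (fun x : ℝ => (x : ℂ)) h2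
    have h3' := congrArg (fun x : ℝ => (x : ℂ)) h3
    simp only [Complex.ofReal_mul, Complex.ofReal_pow] at h2' h3'
    rw [show (Real.exp β : ℂ) ^ 2 * (Complex.sinh z ^ 2 + 1 - (Complex.sinh z ^ 2 +
      Real.exp (-4 * β))) = Real.exp β ^ 2 - Real.exp β ^ 2 * Real.exp (-4 * β) by ring, h2', h3']
    push_cast
    congr 2 <;> · simp; try ring

lemma IsCycleUnion.exists_complexPartitionFn_eq {N n : ℕ} {E : Multiset (Sym2 (Fin N))}
    (h : IsCycleUnion E n) : ∃ L : Multiset ℕ, L.card = n ∧ L.sum = N ∧ (∀ k ∈ L, 0 < k) ∧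
      ∀ (β : ℝ) (z : ℂ), disc β z ≠ 0 →
        complexPartitionFn E β z = (L.map fun k => eigenPlus β z ^ k + eigenMinus β z ^ k).prod := by
  obtain ⟨s, rfl, hc⟩ := h
  -- With all exponents equal to 1, `L` is the multiset of cycle lengths.
  obtain ⟨L, h1, h2, h3, h4⟩ := hc (fun _ => 1) fun _ => one_pos
  refine ⟨L, h1, by simpa using h2, h3, fun β z hz => ?_⟩
  rw [complexPartitionFn, Finset.sum_congr rfl fun σ _ => (prod_transfer s β z σ).symm]
  simpa only [pow_one, trace_transfer_pow hz] using h4 (transfer β z)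

/-! ## The eigenvalues of the transfer matrix -/

lemma disc_ofReal (β b : ℝ) : disc β b = ((Real.sinh b ^ 2 + Real.exp (-4 * β) : ℝ) : ℂ) := by
  simp [disc]

lemma disc_real_pos (β b : ℝ) : 0 < Real.sinh b ^ 2 + Real.exp (-4 * β) := by positivity

lemma disc_mem_slitPlane (β b : ℝ) : disc β b ∈ Complex.slitPlane := by
  rw [disc_ofReal, Complex.ofReal_mem_slitPlane]
  exact disc_real_pos β b

lemma discRoot_ofReal (β b : ℝ) :
    discRoot β b = (√(Real.sinh b ^ 2 + Real.exp (-4 * β)) : ℝ) := by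
  have h := disc_real_pos β b
  rw [discRoot, disc_ofReal, ← Complex.ofReal_log h.le, Real.sqrt_eq_rpow, Real.rpow_def_of_pos h]
  push_cast
  ring_nf

lemma eigenPlus_ofReal (β b : ℝ) : eigenPlus β b = lambdaPlus β b := by
  rw [eigenPlus, discRoot_ofReal, lambdaPlus]
  push_cast
  rfl

lemma lambdaPlus_pos (β b : ℝ) : 0 < lambdaPlus β b :=
  mul_pos (Real.exp_pos _) (add_pos_of_pos_of_nonneg (Real.cosh_pos b) (Real.sqrt_nonneg _))

/-- For `β ≥ 0` the root is at most `cosh b`, so `λ₋ ≥ 0`; as the root is positive, `λ₋ < λ₊`. -/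
lemma norm_eigenMinus_div_lt_one {β : ℝ} (hβ : 0 ≤ β) (b : ℝ) :
    ‖eigenMinus β b / eigenPlus β b‖ < 1 := by
  have hc := Real.cosh_pos b
  have hs : √(Real.sinh b ^ 2 + Real.exp (-4 * β)) ≤ Real.cosh b := by
    rw [Real.sqrt_le_left hc.le, Real.cosh_sq]
    have : Real.exp (-4 * β) ≤ 1 := Real.exp_le_one_iff.2 (by linarith)
    linarith
  have hs' : 0 < √(Real.sinh b ^ 2 + Real.exp (-4 * β)) := Real.sqrt_pos.2 (disc_real_pos β b)
  rw [norm_div, eigenPlus_ofReal, eigenMinus, discRoot_ofReal, ← Complex.ofReal_cosh,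
    ← Complex.ofReal_sub, ← Complex.ofReal_mul, Complex.norm_real, Complex.norm_real,
    Real.norm_of_nonneg (lambdaPlus_pos β b).le,
    Real.norm_of_nonneg (mul_nonneg (Real.exp_pos _).le (sub_nonneg.2 hs)),
    div_lt_one (lambdaPlus_pos β b), lambdaPlus]
  exact mul_lt_mul_of_pos_left (by linarith) (Real.exp_pos _)

lemma discRoot_ne_zero (β : ℝ) (z : ℂ) : discRoot β z ≠ 0 := Complex.exp_ne_zero _

lemma hasDerivAt_disc (β : ℝ) (z : ℂ) :
    HasDerivAt (disc β) (2 * Complex.sinh z * Complex.cosh z) z := by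
  exact (((Complex.hasDerivAt_sinh z).pow 2).add_const (Real.exp (-4 * β) : ℂ)).congr_deriv (by simp)

lemma hasDerivAt_discRoot {β : ℝ} {z : ℂ} (h : disc β z ∈ Complex.slitPlane) :
    HasDerivAt (discRoot β) (Complex.sinh z * Complex.cosh z / discRoot β z) z := by
  have h1 := ((hasDerivAt_disc β z).clog h).div_const 2 |>.cexp
  have h0 := Complex.slitPlane_ne_zero h
  refine h1.congr_deriv ?_
  change discRoot β z * _ = _
  rw [← discRoot_sq h0]
  field_simp [discRoot_ne_zero β z]

lemma hasDerivAt_eigenPlus {β : ℝ} {z : ℂ} (h : disc β z ∈ Complex.slitPlane) :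
    HasDerivAt (eigenPlus β) (eigenPlus β z * (Complex.sinh z / discRoot β z)) z := by
  have h1 := ((Complex.hasDerivAt_cosh z).add (hasDerivAt_discRoot h)).const_mul (Real.exp β : ℂ)
  refine h1.congr_deriv ?_
  rw [eigenPlus]
  field_simp [discRoot_ne_zero β z]
  ring

lemma hasDerivAt_eigenMinus {β : ℝ} {z : ℂ} (h : disc β z ∈ Complex.slitPlane) :
    HasDerivAt (eigenMinus β) (-(eigenMinus β z * (Complex.sinh z / discRoot β z))) z := by
  have h1 := ((Complex.hasDerivAt_cosh z).sub (hasDerivAt_discRoot h)).const_mul (Real.exp β : ℂ)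
  refine h1.congr_deriv ?_
  rw [eigenMinus]
  field_simp [discRoot_ne_zero β z]
  ring

/-- The pressure of the one-dimensional Ising model with a complex external field. -/
noncomputable def complexPressure (β : ℝ) (z : ℂ) : ℂ := Complex.log (eigenPlus β z)

lemma complexPressure_ofReal (β b : ℝ) : complexPressure β b = pressureOneDim β b := by
  rw [complexPressure, eigenPlus_ofReal, pressureOneDim, Complex.ofReal_log (lambdaPlus_pos β b).le]

lemma hasDerivAt_complexPressure {β : ℝ} {z : ℂ} (h : disc β z ∈ Complex.slitPlane)
    (h' : eigenPlus β z ∈ Complex.slitPlane) :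
    HasDerivAt (complexPressure β) (Complex.sinh z / discRoot β z) z := by
  convert! (hasDerivAt_eigenPlus h).clog h' using 1
  rw [mul_div_cancel_left₀ _ (Complex.slitPlane_ne_zero h')]

/-- The quotient rule leaves `cosh z · (discRoot² - sinh² z) / discRoot³`, and the bracket is
`e^{-4β}`. -/
lemma hasDerivAt_sinh_div_discRoot {β : ℝ} {z : ℂ} (h : disc β z ∈ Complex.slitPlane) :
    HasDerivAt (fun z => Complex.sinh z / discRoot β z)
      (Complex.cosh z * Real.exp (-4 * β) / discRoot β z ^ 3) z := by
  convert! (Complex.hasDerivAt_sinh z).div (hasDerivAt_discRoot h) (discRoot_ne_zero β z) using 1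
  have h1 := discRoot_ne_zero β z
  have h2 : (Real.exp (-4 * β) : ℂ) = discRoot β z ^ 2 - Complex.sinh z ^ 2 := by
    rw [discRoot_sq (Complex.slitPlane_ne_zero h), disc]; ring
  rw [h2]
  field_simp

lemma eigenPlus_mem_slitPlane (β b : ℝ) : eigenPlus β b ∈ Complex.slitPlane := by
  rw [eigenPlus_ofReal, Complex.ofReal_mem_slitPlane]
  exact lambdaPlus_pos β b

/-- The susceptibility `cosh B e^{-4β} / (sinh² B + e^{-4β})^{3/2}`. -/
noncomputable def chi (β B : ℝ) : ℝ :=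
  Real.cosh B * Real.exp (-4 * β) / (Real.sinh B ^ 2 + Real.exp (-4 * β)) ^ (3 / 2 : ℝ)

lemma chi_pos (β B : ℝ) : 0 < chi β B :=
  div_pos (mul_pos (Real.cosh_pos B) (Real.exp_pos _)) (Real.rpow_pos_of_pos (disc_real_pos β B) _)

lemma chi_ofReal (β B : ℝ) :
    (chi β B : ℂ) = Complex.cosh B * Real.exp (-4 * β) / discRoot β B ^ 3 := by
  rw [chi, discRoot_ofReal, Real.sqrt_eq_rpow, ← Complex.ofReal_pow, ← Real.rpow_mul_natCast
    (disc_real_pos β B).le]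
  push_cast
  norm_num

lemma susceptibilityOneDim_eq_chi (β B : ℝ) : susceptibilityOneDim β B = chi β B := by
  have h1 : ∀ b : ℝ, HasDerivAt (pressureOneDim β)
      ((Complex.sinh b / discRoot β b).re) b := fun b => by
    have := (hasDerivAt_complexPressure (disc_mem_slitPlane β b)
      (eigenPlus_mem_slitPlane β b)).real_of_complex
    simpa [complexPressure_ofReal] using this
  have h2 := (hasDerivAt_sinh_div_discRoot (disc_mem_slitPlane β B)).real_of_complex
  rw [← chi_ofReal, Complex.ofReal_re] at h2
  change iteratedDeriv 2 (pressureOneDim β) B = _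
  rw [iteratedDeriv_succ, iteratedDeriv_one, funext fun b => (h1 b).deriv]
  exact h2.deriv

/-! ### Analytic control of the partition function near a real field -/

/-- All three conditions hold at the real point `B` and are open, so they persist on a complex disc,
with a uniform spectral gap. -/
lemma exists_ball_eigen {β : ℝ} (hβ : 0 ≤ β) (B : ℝ) : ∃ δ > 0, ∃ ρ < 1,
    ∀ z ∈ Metric.ball (B : ℂ) δ, disc β z ∈ Complex.slitPlane ∧ eigenPlus β z ∈ Complex.slitPlane ∧
      ‖eigenMinus β z / eigenPlus β z‖ ≤ ρ := by
  obtain ⟨ρ, h1, h2⟩ := exists_between (norm_eigenMinus_div_lt_one hβ B)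
  have hd := disc_mem_slitPlane β B
  have hp := eigenPlus_mem_slitPlane β B
  have e1 : ∀ᶠ z in 𝓝 (B : ℂ), disc β z ∈ Complex.slitPlane :=
    (hasDerivAt_disc β B).continuousAt.eventually (Complex.isOpen_slitPlane.mem_nhds hd)
  have e2 : ∀ᶠ z in 𝓝 (B : ℂ), eigenPlus β z ∈ Complex.slitPlane :=
    (hasDerivAt_eigenPlus hd).continuousAt.eventually (Complex.isOpen_slitPlane.mem_nhds hp)
  have e3 : ∀ᶠ z in 𝓝 (B : ℂ), ‖eigenMinus β z / eigenPlus β z‖ < ρ :=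
    ((hasDerivAt_eigenMinus hd).continuousAt.div (hasDerivAt_eigenPlus hd).continuousAt
      (Complex.slitPlane_ne_zero hp)).norm.eventually (gt_mem_nhds h1)
  obtain ⟨δ, hδ, h⟩ := Metric.eventually_nhds_iff_ball.1 (e1.and (e2.and e3))
  exact ⟨δ, hδ, ρ, h2, fun z hz => ⟨(h z hz).1, (h z hz).2.1, (h z hz).2.2.le⟩⟩

lemma prod_map_pow_add_pow (L : Multiset ℕ) {x : ℂ} (hx : x ≠ 0) (y : ℂ) :
    (L.map fun k => x ^ k + y ^ k).prod = x ^ L.sum * (L.map fun k => 1 + (y / x) ^ k).prod := by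
  induction L using Multiset.induction with
  | empty => simp
  | cons k L ih =>
    simp only [Multiset.map_cons, Multiset.prod_cons, Multiset.sum_cons, ih, pow_add, div_pow]
    field_simp

/-- Near the real axis, the logarithm of the partition function of a union of `n` cycles is `N`
times the pressure of the one-dimensional Ising model, up to an analytic error of order `n`. -/
theorem exists_complexPartitionFn_eq_exp {β : ℝ} (hβ : 0 ≤ β) (B : ℝ) :
    ∃ δ > 0, ∃ C ≥ 0, (∀ z ∈ Metric.ball (B : ℂ) δ,
      disc β z ∈ Complex.slitPlane ∧ eigenPlus β z ∈ Complex.slitPlane) ∧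
      ∀ {N n : ℕ} {E : Multiset (Sym2 (Fin N))}, IsCycleUnion E n →
      ∃ U : ℂ → ℂ, DifferentiableOn ℂ U (Metric.ball (B : ℂ) δ) ∧
        (∀ z ∈ Metric.ball (B : ℂ) δ, ‖U z‖ ≤ C * n) ∧
        ∀ z ∈ Metric.ball (B : ℂ) δ,
          complexPartitionFn E β z = Complex.exp (N * complexPressure β z + U z) := by
  obtain ⟨δ, hδ, ρ, hρ, h⟩ := exists_ball_eigen hβ B
  have hρ0 : 0 ≤ ρ := (norm_nonneg _).trans (h B (Metric.mem_ball_self hδ)).2.2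
  have hρ1 : 0 < 1 - ρ := sub_pos.2 hρ
  -- The constant is the bound of `Complex.norm_log_one_add_le` for `log (1 + w)` at `‖w‖ = ρ`.
  -- Neither it nor `δ` depends on the graph.
  refine ⟨δ, hδ, ρ ^ 2 * (1 - ρ)⁻¹ / 2 + ρ, by positivity, fun z hz => ⟨(h z hz).1, (h z hz).2.1⟩,
    fun {N n E} hE => ?_⟩
  obtain ⟨L, hLn, hLs, hL0, hL⟩ := hE.exists_complexPartitionFn_eq
  let r : ℂ → ℂ := fun z => eigenMinus β z / eigenPlus β z
  -- Positive cycle lengths matter here: a power with `k = 0` would be 1.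
  have hr : ∀ z ∈ Metric.ball (B : ℂ) δ, ∀ k ∈ L, ‖r z ^ k‖ ≤ ρ := fun z hz k hk => by
    rw [norm_pow]
    exact (pow_le_of_le_one (norm_nonneg _) ((h z hz).2.2.trans hρ.le) (hL0 k hk).ne').trans
      (h z hz).2.2
  have hslit : ∀ z ∈ Metric.ball (B : ℂ) δ, ∀ k ∈ L, 1 + r z ^ k ∈ Complex.slitPlane :=
    fun z hz k hk => Complex.mem_slitPlane_of_norm_lt_one ((hr z hz k hk).trans_lt hρ)
  refine ⟨fun z => (L.map fun k => Complex.log (1 + r z ^ k)).sum, fun z hz => ?_,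
    fun z hz => ?_, fun z hz => ?_⟩
  · have hrd : DifferentiableAt ℂ r z :=
      (hasDerivAt_eigenMinus (h z hz).1).differentiableAt.div
        (hasDerivAt_eigenPlus (h z hz).1).differentiableAt (Complex.slitPlane_ne_zero (h z hz).2.1)
    refine DifferentiableAt.differentiableWithinAt ?_
    have hk := hslit z hz
    clear hL hL0 hLs hLn hr hslit
    induction L using Multiset.induction with
    | empty => simp
    | cons k L ih =>
      simp only [Multiset.map_cons, Multiset.sum_cons]
      exact (((hrd.pow k).const_add 1).clog (hk k (Multiset.mem_cons_self k L))).add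
        (ih fun j hj => hk j (Multiset.mem_cons_of_mem hj))
  · have hlog : ∀ k ∈ L, ‖Complex.log (1 + r z ^ k)‖ ≤ ρ ^ 2 * (1 - ρ)⁻¹ / 2 + ρ := fun k hk => by
      have h1 := hr z hz k hk
      have h2 := Complex.norm_log_one_add_le (h1.trans_lt hρ)
      refine h2.trans ?_
      have h3 : 0 ≤ (1 - ‖r z ^ k‖)⁻¹ := inv_nonneg.2 (by linarith)
      gcongr
    refine (norm_multiset_sum_le _).trans ?_
    rw [Multiset.map_map]
    refine (Multiset.sum_le_card_nsmul _ (ρ ^ 2 * (1 - ρ)⁻¹ / 2 + ρ) fun x hx => ?_).trans ?_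
    · obtain ⟨k, hk, rfl⟩ := Multiset.mem_map.1 hx
      exact hlog k hk
    · rw [Multiset.card_map, hLn, nsmul_eq_mul, mul_comm]
  · have hp := Complex.slitPlane_ne_zero (h z hz).2.1
    rw [hL β z (Complex.slitPlane_ne_zero (h z hz).1), Complex.exp_add, Complex.exp_multiset_sum,
      Complex.exp_nat_mul, complexPressure, Complex.exp_log hp, Multiset.map_map,
      prod_map_pow_add_pow L hp, hLs]
    congr 2
    exact Multiset.map_congr rfl fun k hk =>
      (Complex.exp_log (Complex.slitPlane_ne_zero (hslit z hz k hk))).symm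

/-! ## Moments of the total spin -/

/-- The unnormalized moments of the total spin with a complex external field. -/
noncomputable def complexMoment {N : ℕ} (E : Multiset (Sym2 (Fin N))) (β : ℝ) (j : ℕ) (z : ℂ) : ℂ :=
  ∑ σ : Config N, (totalSpin σ : ℂ) ^ j *
    Complex.exp ((β * (E.map (edgeSpin σ)).sum : ℝ) + z * totalSpin σ)

lemma hasDerivAt_complexMoment {N : ℕ} (E : Multiset (Sym2 (Fin N))) (β : ℝ) (j : ℕ) (z : ℂ) :
    HasDerivAt (complexMoment E β j) (complexMoment E β (j + 1) z) z := by
  refine HasDerivAt.fun_sum fun σ _ => ?_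
  have h1 := ((((hasDerivAt_id z).mul_const (totalSpin σ : ℂ)).const_add
    ((β * (E.map (edgeSpin σ)).sum : ℝ) : ℂ)).cexp).const_mul ((totalSpin σ : ℂ) ^ j)
  refine h1.congr_deriv ?_
  simp only [id, one_mul, pow_succ]
  ring

lemma complexMoment_zero {N : ℕ} (E : Multiset (Sym2 (Fin N))) (β : ℝ) :
    complexMoment E β 0 = complexPartitionFn E β := by
  funext z
  simp [complexMoment, complexPartitionFn]

/-- The moments of the total spin under the Boltzmann–Gibbs measure. -/
noncomputable def gibbsMoment {N : ℕ} (E : Multiset (Sym2 (Fin N))) (β B : ℝ) (j : ℕ) : ℝ :=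
  ∑ σ : Config N, gibbsProb E β B σ * totalSpin σ ^ j

lemma gibbsMoment_eq {N : ℕ} (E : Multiset (Sym2 (Fin N))) (β B : ℝ) (j : ℕ) :
    (gibbsMoment E β B j : ℂ) = complexMoment E β j B / complexPartitionFn E β B := by
  rw [complexPartitionFn_ofReal, complexMoment, gibbsMoment, Finset.sum_div]
  push_cast
  refine Finset.sum_congr rfl fun σ _ => ?_
  rw [gibbsProb, weight]
  push_cast
  ring

/-- The characteristic function is an imaginary shift of the field. -/
lemma sum_gibbsProb_mul_cexp {N : ℕ} (E : Multiset (Sym2 (Fin N))) (β B s : ℝ) :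
    ∑ σ, (gibbsProb E β B σ : ℂ) * Complex.exp (s * totalSpin σ * Complex.I) =
      complexPartitionFn E β (B + s * Complex.I) / complexPartitionFn E β B := by
  rw [complexPartitionFn_ofReal, complexPartitionFn, Finset.sum_div]
  refine Finset.sum_congr rfl fun σ _ => ?_
  rw [gibbsProb, weight]
  push_cast
  rw [div_mul_eq_mul_div, ← Complex.exp_add]
  congr 2
  ring

/-- Cauchy's estimate on circles of radius `δ / 4`, which stay inside the larger ball. -/
lemma norm_deriv_le_of_ball {f : ℂ → ℂ} {c : ℂ} {δ M : ℝ} (hδ : 0 < δ)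
    (hf : DifferentiableOn ℂ f (Metric.ball c δ)) (hM : ∀ z ∈ Metric.ball c δ, ‖f z‖ ≤ M) :
    ∀ z ∈ Metric.ball c (δ / 2), ‖deriv f z‖ ≤ M / (δ / 4) := by
  intro z hz
  have hsub : Metric.closedBall z (δ / 4) ⊆ Metric.ball c δ := fun y hy => by
    rw [Metric.mem_ball] at hz ⊢
    rw [Metric.mem_closedBall] at hy
    linarith [dist_triangle y z c]
  exact Complex.norm_deriv_le_of_forall_mem_sphere_norm_le (by linarith)
    ((hf.mono hsub).diffContOnCl_ball subset_rfl)
    fun y hy => hM y (hsub (Metric.sphere_subset_closedBall hy))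

/-- The magnetization per site of the one-dimensional Ising model. -/
noncomputable def magnetization (β B : ℝ) : ℝ :=
  Real.sinh B / √(Real.sinh B ^ 2 + Real.exp (-4 * β))

lemma magnetization_ofReal (β B : ℝ) :
    (magnetization β B : ℂ) = Complex.sinh B / discRoot β B := by
  rw [magnetization, discRoot_ofReal]
  push_cast
  rfl

/-- The mean and variance of the total spin are the first two derivatives of `log Z = N ψ + U` in
the field. Cauchy's estimates turn the bound on `U` into bounds on `U'` and `U''`, all of order `n`;
the increment of `U` in the imaginary direction is `D`. -/
theorem exists_gibbs_bounds {β : ℝ} (hβ : 0 ≤ β) (B : ℝ) :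
    ∃ δ > 0, ∃ C ≥ 0, ∀ {N n : ℕ} {E : Multiset (Sym2 (Fin N))}, IsCycleUnion E n →
      |Real.log (partitionFn E β B) - N * pressureOneDim β B| ≤ C * n ∧
      |gibbsMoment E β B 1 - N * magnetization β B| ≤ C * n ∧
      |gibbsMoment E β B 2 - gibbsMoment E β B 1 ^ 2 - N * chi β B| ≤ C * n ∧
      ∀ s : ℝ, |s| < δ → ∃ D : ℂ, ‖D‖ ≤ C * n * |s| ∧
        ∑ σ, (gibbsProb E β B σ : ℂ) * Complex.exp (s * totalSpin σ * Complex.I) =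
          Complex.exp (N * (complexPressure β (B + s * Complex.I) - complexPressure β B) + D) := by
  obtain ⟨δ, hδ, C, hC, hslit, hU⟩ := exists_complexPartitionFn_eq_exp hβ B
  have hδ2 : 0 < δ / 2 := by linarith
  have hsub : Metric.ball (B : ℂ) (δ / 2) ⊆ Metric.ball (B : ℂ) δ :=
    Metric.ball_subset_ball (by linarith)
  have hB := Metric.mem_ball_self (x := (B : ℂ)) hδ
  have hB2 := Metric.mem_ball_self (x := (B : ℂ)) hδ2
  have hB4 := Metric.mem_ball_self (x := (B : ℂ)) (half_pos hδ2)
  -- Two successive Cauchy estimates, on balls of radius `δ` and `δ / 2`, give `C₁` for `U'` and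
  -- `C₂` for `U''`.
  set C₁ := C / (δ / 4) with hC₁
  set C₂ := C₁ / (δ / 2 / 4) with hC₂
  have h1pos : 0 ≤ C₁ := by positivity
  have h2pos : 0 ≤ C₂ := by positivity
  refine ⟨δ / 2, hδ2, C + C₁ + C₂, by positivity, fun {N n E} hE => ?_⟩
  obtain ⟨U, hUd, hUn, hUe⟩ := hU hE
  have hUd1 : DifferentiableOn ℂ (deriv U) (Metric.ball (B : ℂ) δ) :=
    hUd.deriv Metric.isOpen_ball
  have hn1 : ∀ z ∈ Metric.ball (B : ℂ) (δ / 2), ‖deriv U z‖ ≤ C₁ * n := fun z hz =>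
    (norm_deriv_le_of_ball hδ hUd hUn z hz).trans_eq (by rw [hC₁]; ring)
  have hn2 : ‖deriv (deriv U) B‖ ≤ C₂ * n :=
    (norm_deriv_le_of_ball hδ2 (hUd1.mono hsub) hn1 B hB4).trans_eq (by rw [hC₂]; ring)
  have hle : ∀ {c x : ℝ}, x ≤ c * n → c ≤ C + C₁ + C₂ → x ≤ (C + C₁ + C₂) * n :=
    fun h1 h2 => h1.trans (by gcongr)
  -- the first two derivatives of the partition function
  have hH : ∀ z ∈ Metric.ball (B : ℂ) δ,
      HasDerivAt (fun z => N * complexPressure β z + U z)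
        (N * (Complex.sinh z / discRoot β z) + deriv U z) z := fun z hz =>
    ((hasDerivAt_complexPressure (hslit z hz).1 (hslit z hz).2).const_mul (N : ℂ)).add
      (hUd.differentiableAt (Metric.isOpen_ball.mem_nhds hz)).hasDerivAt
  have hM1 : ∀ z ∈ Metric.ball (B : ℂ) δ, complexMoment E β 1 z = complexPartitionFn E β z *
      (N * (Complex.sinh z / discRoot β z) + deriv U z) := fun z hz => by
    have h1 := hasDerivAt_complexMoment E β 0 z
    rw [complexMoment_zero] at h1
    rw [hUe z hz]
    refine h1.unique ((hH z hz).cexp.congr_of_eventuallyEq ?_)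
    exact eventually_of_mem (Metric.isOpen_ball.mem_nhds hz) hUe
  have hM2 : complexMoment E β 2 B = complexMoment E β 1 B *
      (N * (Complex.sinh B / discRoot β B) + deriv U B) +
      complexPartitionFn E β B * (N * chi β B + deriv (deriv U) B) := by
    refine (hasDerivAt_complexMoment E β 1 B).unique (HasDerivAt.congr_of_eventuallyEq ?_
      (eventually_of_mem (Metric.isOpen_ball.mem_nhds hB) hM1))
    have h1 := hasDerivAt_complexMoment E β 0 B
    rw [complexMoment_zero] at h1
    rw [chi_ofReal]
    exact h1.mul (((hasDerivAt_sinh_div_discRoot (hslit B hB).1).const_mul (N : ℂ)).add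
      (hUd1.differentiableAt (Metric.isOpen_ball.mem_nhds hB)).hasDerivAt)
  have hZ : complexPartitionFn E β B ≠ 0 := by
    rw [hUe B hB]
    exact Complex.exp_ne_zero _
  have hm1 : (gibbsMoment E β B 1 : ℂ) = N * magnetization β B + deriv U B := by
    rw [gibbsMoment_eq, hM1 B hB, mul_div_cancel_left₀ _ hZ, magnetization_ofReal]
  have hm2 : (gibbsMoment E β B 2 : ℂ) = gibbsMoment E β B 1 ^ 2 +
      (N * chi β B + deriv (deriv U) B) := by
    rw [gibbsMoment_eq, hM2, add_div, mul_div_cancel_left₀ _ hZ, mul_div_right_comm,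
      ← gibbsMoment_eq, ← magnetization_ofReal, ← hm1, pow_two]
  refine ⟨hle (c := C) ?_ (by linarith), hle (c := C₁) ?_ (by linarith),
    hle (c := C₂) ?_ (by linarith), fun s hs => ?_⟩
  · have h1 : Real.log (partitionFn E β B) = (N * pressureOneDim β B) + (U B).re := by
      have h2 : partitionFn E β B = ‖complexPartitionFn E β B‖ := by
        rw [complexPartitionFn_ofReal, Complex.norm_real,
          Real.norm_of_nonneg (partitionFn_pos E β B).le]
      rw [h2, hUe B hB, Complex.norm_exp, Real.log_exp, complexPressure_ofReal]
      simp
    rw [h1, add_sub_cancel_left]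
    exact (Complex.abs_re_le_norm _).trans (hUn B hB)
  · refine le_trans (le_of_eq ?_) (hn1 B hB2)
    rw [eq_sub_of_add_eq' hm1.symm, ← Real.norm_eq_abs, ← Complex.norm_real]
    push_cast
    rfl
  · refine le_trans (le_of_eq ?_) hn2
    rw [eq_sub_of_add_eq' (eq_sub_of_add_eq' hm2.symm), ← Real.norm_eq_abs, ← Complex.norm_real]
    push_cast
    rfl
  · have hz : (B + s * Complex.I : ℂ) ∈ Metric.ball (B : ℂ) (δ / 2) := by
      simpa [Metric.mem_ball, dist_eq_norm] using hs
    refine ⟨U (B + s * Complex.I) - U B, ?_, ?_⟩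
    -- The mean value inequality produces the factor `|s|`, without which `D` would not be small.
    · have h1 := (convex_ball (B : ℂ) (δ / 2)).norm_image_sub_le_of_norm_deriv_le (f := U)
        (fun z hz => hUd.differentiableAt (Metric.isOpen_ball.mem_nhds (hsub hz))) hn1 hB2 hz
      rw [add_sub_cancel_left, norm_mul, Complex.norm_I, mul_one, Complex.norm_real,
        Real.norm_eq_abs] at h1
      refine h1.trans ?_
      gcongr
      linarith
    · rw [sum_gibbsProb_mul_cexp, hUe B hB, hUe _ (hsub hz), ← Complex.exp_sub]
      congr 1
      ring

/-! ## Almost sure limits -/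

lemma integral_sum_dirac {N : ℕ} {F : Type*} [NormedAddCommGroup F] [NormedSpace ℝ F]
    [CompleteSpace F] {p : Config N → ℝ} (hp : ∀ σ, 0 ≤ p σ) (f : Config N → F) :
    ∫ σ, f σ ∂(∑ σ : Config N, ENNReal.ofReal (p σ) • Measure.dirac σ) = ∑ σ, p σ • f σ := by
  rw [integral_finsetSum_measure fun σ _ =>
    (integrable_dirac (by simp)).smul_measure ENNReal.ofReal_ne_top]
  simp [integral_smul_measure, ENNReal.toReal_ofReal (hp _)]

lemma susceptibility_eq {N : ℕ} (E : Multiset (Sym2 (Fin N))) (β B : ℝ) :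
    susceptibility E β B = (gibbsMoment E β B 2 - gibbsMoment E β B 1 ^ 2) / N := by
  rw [susceptibility, variance_eq_sub (MemLp.of_discrete)]
  simp only [gibbsMeasure]
  rw [integral_sum_dirac (gibbsProb_nonneg E β B), integral_sum_dirac (gibbsProb_nonneg E β B)]
  have h : (√(N : ℝ)) ^ 2 = N := Real.sq_sqrt (Nat.cast_nonneg N)
  simp only [Pi.pow_apply, div_pow, h, smul_eq_mul, ← mul_div_assoc, ← Finset.sum_div]
  simp only [gibbsMoment, pow_one, ← sub_div]

lemma tendsto_div_of_abs_sub_le {a b : ℕ → ℝ} {x : ℝ}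
    (h : ∀ᶠ N : ℕ in atTop, |a N - N * x| ≤ b N) (hb : Tendsto (fun N : ℕ => b N / N) atTop (𝓝 0)) :
    Tendsto (fun N : ℕ => a N / N) atTop (𝓝 x) := by
  rw [tendsto_iff_norm_sub_tendsto_zero]
  refine squeeze_zero' (Eventually.of_forall fun _ => norm_nonneg _) ?_ hb
  filter_upwards [h, eventually_gt_atTop 0] with N hN hpos
  have hN0 : (0 : ℝ) < N := Nat.cast_pos.2 hpos
  rw [Real.norm_eq_abs, le_div_iff₀ hN0, ← abs_of_pos hN0, ← abs_mul, abs_of_pos hN0, sub_mul,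
    div_mul_cancel₀ _ hN0.ne', mul_comm x]
  exact hN

lemma tendsto_const_div_natCast (c : ℝ) : Tendsto (fun N : ℕ => c / N) atTop (𝓝 0) :=
  tendsto_const_div_atTop_nhds_zero_nat c

lemma isCycleUnion_cycleEdges (N : ℕ) : IsCycleUnion (cycleEdges (N + 1)) 1 :=
  ⟨finRotate (N + 1), rfl, hasCycles_finRotate N⟩

lemma abs_edgeSpin {N : ℕ} (σ : Config N) (e : Sym2 (Fin N)) : |edgeSpin σ e| = 1 := by
  induction e using Sym2.ind with
  | _ i j =>
    change |spin σ i * spin σ j| = 1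
    rw [spin, spin]
    rcases Int.units_eq_one_or (σ i) with h | h <;> rcases Int.units_eq_one_or (σ j) with h' | h' <;>
      simp [h, h']

lemma cycleEdges_eq_cons (N : ℕ) : cycleEdges (N + 1) =
    s(Fin.last N, finRotate (N + 1) (Fin.last N)) ::ₘ pathEdges (N + 1) := by
  have h : (Finset.univ : Finset (Fin (N + 1))) = insert (Fin.last N)
      (Finset.univ.filter fun i : Fin (N + 1) => i.val + 1 < N + 1) := by
    ext i
    simp only [Finset.mem_univ, Finset.mem_insert, Finset.mem_filter, true_and, true_iff,
      Fin.ext_iff, Fin.val_last]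
    omega
  rw [cycleEdges, pathEdges, h, Finset.insert_val_of_notMem (by simp), Multiset.map_cons, ← h]

/-- One edge changes every weight by a factor between `e^{-β}` and `e^β`. This compares free with
periodic boundary conditions. -/
lemma abs_log_partitionFn_cons_sub_le {N : ℕ} (e : Sym2 (Fin N)) (E : Multiset (Sym2 (Fin N)))
    {β : ℝ} (hβ : 0 ≤ β) (B : ℝ) :
    |Real.log (partitionFn (e ::ₘ E) β B) - Real.log (partitionFn E β B)| ≤ β := by
  have hw : ∀ σ, weight (e ::ₘ E) β B σ = Real.exp (β * edgeSpin σ e) * weight E β B σ := fun σ => by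
    rw [weight, weight, ← Real.exp_add, Multiset.map_cons, Multiset.sum_cons]
    ring_nf
  have hE := partitionFn_pos E β B
  have h1 : partitionFn (e ::ₘ E) β B ≤ Real.exp β * partitionFn E β B := by
    rw [partitionFn, partitionFn, Finset.mul_sum]
    refine Finset.sum_le_sum fun σ _ => ?_
    rw [hw]
    refine mul_le_mul_of_nonneg_right (Real.exp_le_exp.2 ?_) (weight_pos E β B σ).le
    exact mul_le_of_le_one_right hβ (le_of_abs_le (abs_edgeSpin σ e).le)
  have h2 : Real.exp (-β) * partitionFn E β B ≤ partitionFn (e ::ₘ E) β B := by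
    rw [partitionFn, partitionFn, Finset.mul_sum]
    refine Finset.sum_le_sum fun σ _ => ?_
    rw [hw]
    refine mul_le_mul_of_nonneg_right (Real.exp_le_exp.2 ?_) (weight_pos E β B σ).le
    nlinarith [neg_le_of_abs_le (abs_edgeSpin σ e).le]
  have h3 := Real.log_le_log (partitionFn_pos _ β B) h1
  have h4 := Real.log_le_log (by positivity) h2
  rw [Real.log_mul (Real.exp_pos _).ne' hE.ne', Real.log_exp] at h3 h4
  rw [abs_le]
  constructor <;> linarith

lemma tendsto_pressure_cycleEdges {β : ℝ} (hβ : 0 ≤ β) (B : ℝ) :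
    Tendsto (fun N : ℕ => pressure (cycleEdges N) β B) atTop (𝓝 (pressureOneDim β B)) := by
  obtain ⟨δ, -, C, -, h⟩ := exists_gibbs_bounds hβ B
  refine tendsto_div_of_abs_sub_le (b := fun _ => C) ?_ (tendsto_const_div_natCast C)
  filter_upwards [eventually_gt_atTop 0] with N hN
  obtain ⟨M, rfl⟩ := Nat.exists_eq_succ_of_ne_zero hN.ne'
  simpa using (h (isCycleUnion_cycleEdges M)).1

lemma tendsto_pressure_pathEdges {β : ℝ} (hβ : 0 ≤ β) (B : ℝ) :
    Tendsto (fun N : ℕ => pressure (pathEdges N) β B) atTop (𝓝 (pressureOneDim β B)) := by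
  obtain ⟨δ, -, C, -, h⟩ := exists_gibbs_bounds hβ B
  refine tendsto_div_of_abs_sub_le (b := fun _ => C + β) ?_ (tendsto_const_div_natCast _)
  filter_upwards [eventually_gt_atTop 0] with N hN
  obtain ⟨M, rfl⟩ := Nat.exists_eq_succ_of_ne_zero hN.ne'
  have h1 := (h (isCycleUnion_cycleEdges M)).1
  have h2 := abs_log_partitionFn_cons_sub_le
    s(Fin.last M, finRotate (M + 1) (Fin.last M)) (pathEdges (M + 1)) hβ B
  rw [← cycleEdges_eq_cons] at h2
  rw [Nat.cast_one, mul_one] at h1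
  rw [abs_le] at *
  constructor <;> linarith

/-! ### The number of cycles of the configuration model -/

lemma integral_cmLaw (N : ℕ) (f : Pairing (twoRegular N) → ℝ) :
    ∫ π, f π ∂(cmLaw (twoRegular N)) = (∑ π, f π) / Fintype.card (Pairing (twoRegular N)) := by
  rw [integral_fintype Integrable.of_finite, Finset.sum_div]
  refine Finset.sum_congr rfl fun π _ => ?_
  rw [measureReal_def, cmLaw, uniformOn_univ, Measure.count_singleton]
  simp [div_eq_inv_mul]

/-- The number of cycles of a pairing. -/
noncomputable def numCycles {N : ℕ} : Pairing (twoRegular N) → ℕ :=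
  (exists_numCycles N).choose

lemma isCycleUnion_edges {N : ℕ} (π : Pairing (twoRegular N)) :
    IsCycleUnion (edges π) (numCycles π) :=
  (exists_numCycles N).choose_spec.1 π

lemma integral_three_pow_numCycles (N : ℕ) :
    ∫ π : Pairing (twoRegular N), (3 : ℝ) ^ numCycles π ∂(cmLaw (twoRegular N)) = 2 * N + 1 := by
  have h := congrArg (fun n : ℕ => (n : ℝ)) (exists_numCycles N).choose_spec.2
  have hc : (Fintype.card (Pairing (twoRegular N)) : ℝ) ≠ 0 :=
    Nat.cast_ne_zero.2 Fintype.card_ne_zero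
  rw [integral_cmLaw, div_eq_iff hc]
  push_cast at h
  exact h

/-- Jensen's inequality `Q_N(3^(pK)) ≤ (Q_N(3^K))^p`, obtained from convexity of `exp` between `K
log 3` and `log (2N + 1)` with weights `p` and `1 - p`. -/
lemma integral_exp_numCycles_le (N : ℕ) {p : ℝ} (hp0 : 0 ≤ p) (hp1 : p ≤ 1) :
    ∫ π : Pairing (twoRegular N), Real.exp (p * Real.log 3 * numCycles π) ∂(cmLaw (twoRegular N)) ≤
      Real.exp (p * Real.log (2 * N + 1)) := by
  have hM : (0 : ℝ) < 2 * N + 1 := by positivity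
  have h1 : ∀ π : Pairing (twoRegular N), Real.exp (p * Real.log 3 * numCycles π) ≤
      (p * 3 ^ numCycles π + (1 - p) * (2 * N + 1)) *
        Real.exp (-((1 - p) * Real.log (2 * N + 1))) := fun π => by
    have h2 := convexOn_exp.2 (Set.mem_univ (Real.log 3 * numCycles π))
      (Set.mem_univ (Real.log (2 * N + 1))) hp0 (sub_nonneg.2 hp1) (by ring)
    simp only [smul_eq_mul] at h2
    rw [Real.exp_log hM, mul_comm (Real.log 3), Real.exp_nat_mul, Real.exp_log (by norm_num)] at h2
    rw [Real.exp_neg, ← div_eq_mul_inv, le_div_iff₀ (Real.exp_pos _), ← Real.exp_add]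
    refine le_trans (le_of_eq ?_) h2
    ring_nf
  refine (integral_mono Integrable.of_finite Integrable.of_finite h1).trans (le_of_eq ?_)
  rw [integral_mul_const, integral_add Integrable.of_finite Integrable.of_finite,
    integral_const_mul, integral_three_pow_numCycles]
  simp only [integral_const, probReal_univ, one_smul]
  rw [show p * (2 * N + 1) + (1 - p) * (2 * N + 1) = (2 * N + 1 : ℝ) by ring]
  nth_rw 1 [← Real.exp_log hM]
  rw [← Real.exp_add]
  ring_nf

/-- Jensen's inequality for `log`, through its tangent at the mean `2N + 1` of `3^K`. -/
lemma integral_numCycles_le (N : ℕ) :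
    ∫ π : Pairing (twoRegular N), (numCycles π : ℝ) ∂(cmLaw (twoRegular N)) ≤
      Real.log (2 * N + 1) / Real.log 3 := by
  have hM : (0 : ℝ) < 2 * N + 1 := by positivity
  have h3 : 0 < Real.log 3 := Real.log_pos (by norm_num)
  rw [le_div_iff₀ h3, ← integral_mul_const]
  have h1 : ∀ π : Pairing (twoRegular N), (numCycles π : ℝ) * Real.log 3 ≤
      3 ^ numCycles π / (2 * N + 1) + (Real.log (2 * N + 1) - 1) := fun π => by
    have h2 := Real.log_le_sub_one_of_pos (x := 3 ^ numCycles π / (2 * N + 1 : ℝ)) (by positivity)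
    rw [Real.log_div (by positivity) hM.ne', Real.log_pow] at h2
    linarith
  refine (integral_mono Integrable.of_finite Integrable.of_finite h1).trans (le_of_eq ?_)
  rw [integral_add Integrable.of_finite Integrable.of_finite, integral_div,
    integral_three_pow_numCycles, div_self hM.ne']
  simp

/-- Markov's inequality with `2N + 1 ≤ 3N`; the cube makes the bound summable. -/
lemma cmLaw_real_le (N : ℕ) (hN : 0 < N) :
    (cmLaw (twoRegular N)).real {π | (N : ℝ) ^ 3 ≤ 3 ^ numCycles π} ≤ 3 / (N : ℝ) ^ 2 := by
  have hN1 : (1 : ℝ) ≤ N := Nat.one_le_cast.2 hN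
  have h := mul_meas_ge_le_integral_of_nonneg (μ := cmLaw (twoRegular N))
    (f := fun π => (3 : ℝ) ^ numCycles π) (Eventually.of_forall fun π => by positivity)
    Integrable.of_finite ((N : ℝ) ^ 3)
  rw [integral_three_pow_numCycles] at h
  rw [le_div_iff₀ (by positivity)]
  have h4 : (N : ℝ) * ((cmLaw (twoRegular N)).real {π | (N : ℝ) ^ 3 ≤ 3 ^ numCycles π} * N ^ 2) ≤
      N * 3 := by
    refine le_trans (le_of_eq (by ring)) (h.trans ?_)
    linarith
  exact le_of_mul_le_mul_left h4 (by linarith)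

/-- Almost surely, the number of cycles is eventually at most `3 log N / log 3`. -/
lemma ae_eventually_numCycles_lt {Ω : Type*} [MeasurableSpace Ω] (Pr : Measure Ω)
    [IsProbabilityMeasure Pr] (G : ∀ N : ℕ, Ω → Pairing (twoRegular N))
    (hG : ∀ N : ℕ, HasLaw (G N) (cmLaw (twoRegular N)) Pr) :
    ∀ᵐ ω ∂Pr, ∀ᶠ N : ℕ in atTop, (3 : ℝ) ^ numCycles (G N ω) < (N : ℝ) ^ 3 := by
  have hs : Summable fun N : ℕ => 3 / (N : ℝ) ^ 2 := by
    simpa [div_eq_mul_inv] using (Real.summable_nat_pow_inv.2 one_lt_two).mul_left 3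
  -- At `N = 0` the inequality always holds while `3 / 0 ^ 2 = 0`, so the event includes `0 < N`.
  have hle : ∀ N : ℕ, Pr {ω | 0 < N ∧ (N : ℝ) ^ 3 ≤ 3 ^ numCycles (G N ω)} ≤
      ENNReal.ofReal (3 / (N : ℝ) ^ 2) := fun N => by
    rcases Nat.eq_zero_or_pos N with rfl | hN
    · simp
    · simp only [hN, true_and]
      rw [(hG N).measure_eq (p := fun π => (N : ℝ) ^ 3 ≤ 3 ^ numCycles π)
        (MeasurableSet.of_discrete), ← ofReal_measureReal]
      exact ENNReal.ofReal_le_ofReal (cmLaw_real_le N hN)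
  -- This half of Borel–Cantelli needs no independence, so the coupling of the graphs is irrelevant.
  have h := ae_eventually_notMem (μ := Pr)
    (s := fun N : ℕ => {ω | 0 < N ∧ (N : ℝ) ^ 3 ≤ 3 ^ numCycles (G N ω)})
    (ne_top_of_le_ne_top hs.tsum_ofReal_ne_top (ENNReal.tsum_le_tsum hle))
  filter_upwards [h] with ω hω
  filter_upwards [hω, eventually_gt_atTop 0] with N hN hpos
  by_contra hcon
  exact hN ⟨hpos, not_lt.1 hcon⟩

lemma tendsto_log_div_sqrt (x : ℝ) (hx : 0 < x) :
    Tendsto (fun N : ℕ => Real.log (x * N) / √(N : ℝ)) atTop (𝓝 0) := by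
  have h1 : Tendsto (fun N : ℕ => Real.log N / √(N : ℝ)) atTop (𝓝 0) := by
    have := (isLittleO_log_rpow_atTop (r := 1 / 2) (by norm_num)).tendsto_div_nhds_zero.comp
      tendsto_natCast_atTop_atTop
    simpa [Real.sqrt_eq_rpow, Function.comp_def] using this
  have h2 : Tendsto (fun N : ℕ => Real.log x / √(N : ℝ)) atTop (𝓝 0) :=
    tendsto_const_nhds.div_atTop (Real.tendsto_sqrt_atTop.comp tendsto_natCast_atTop_atTop)
  have h3 := h2.add h1
  rw [add_zero] at h3
  refine h3.congr' ?_
  filter_upwards [eventually_gt_atTop 0] with N hN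
  rw [Real.log_mul hx.ne' (Nat.cast_pos.2 hN).ne', add_div]

lemma tendsto_log_two_mul_add_one_div_sqrt :
    Tendsto (fun N : ℕ => Real.log (2 * N + 1) / √(N : ℝ)) atTop (𝓝 0) := by
  refine squeeze_zero' (Eventually.of_forall fun N =>
    div_nonneg (Real.log_nonneg (by linarith [Nat.cast_nonneg (α := ℝ) N])) (Real.sqrt_nonneg _)) ?_
    (tendsto_log_div_sqrt 3 (by norm_num))
  filter_upwards [eventually_gt_atTop 0] with N hN
  have hN1 : (1 : ℝ) ≤ N := Nat.one_le_cast.2 hN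
  gcongr
  linarith

lemma tendsto_log_div_natCast : Tendsto (fun N : ℕ => Real.log N / (N : ℝ)) atTop (𝓝 0) := by
  have := (Real.isLittleO_log_id_atTop).tendsto_div_nhds_zero.comp
    tendsto_natCast_atTop_atTop
  exact this

lemma ae_tendsto_numCycles_div {Ω : Type*} [MeasurableSpace Ω] (Pr : Measure Ω)
    [IsProbabilityMeasure Pr] (G : ∀ N : ℕ, Ω → Pairing (twoRegular N))
    (hG : ∀ N : ℕ, HasLaw (G N) (cmLaw (twoRegular N)) Pr) :
    ∀ᵐ ω ∂Pr, Tendsto (fun N : ℕ => (numCycles (G N ω) : ℝ) / N) atTop (𝓝 0) := by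
  filter_upwards [ae_eventually_numCycles_lt Pr G hG] with ω hω
  have h3 : 0 < Real.log 3 := Real.log_pos (by norm_num)
  have hlim := tendsto_log_div_natCast.const_mul (3 / Real.log 3)
  rw [mul_zero] at hlim
  refine squeeze_zero' (Eventually.of_forall fun N => by positivity) ?_ hlim
  filter_upwards [hω] with N hN
  have h := Real.log_le_log (by positivity) hN.le
  rw [Real.log_pow, Real.log_pow] at h
  rw [← mul_div_assoc]
  gcongr
  rw [div_mul_eq_mul_div, le_div_iff₀ h3]
  exact_mod_cast h

lemma ae_tendsto_pressure {Ω : Type*} [MeasurableSpace Ω] (Pr : Measure Ω)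
    [IsProbabilityMeasure Pr] (G : ∀ N : ℕ, Ω → Pairing (twoRegular N))
    (hG : ∀ N : ℕ, HasLaw (G N) (cmLaw (twoRegular N)) Pr) {β : ℝ} (hβ : 0 ≤ β) (B : ℝ) :
    ∀ᵐ ω ∂Pr, Tendsto (fun N : ℕ => pressure (edges (G N ω)) β B) atTop
      (𝓝 (pressureOneDim β B)) := by
  obtain ⟨δ, -, C, -, h⟩ := exists_gibbs_bounds hβ B
  filter_upwards [ae_tendsto_numCycles_div Pr G hG] with ω hω
  have hlim := hω.const_mul C
  rw [mul_zero] at hlim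
  refine tendsto_div_of_abs_sub_le
    (Eventually.of_forall fun N => (h (isCycleUnion_edges (G N ω))).1) ?_
  simpa only [mul_div_assoc] using hlim

lemma ae_tendsto_susceptibility {Ω : Type*} [MeasurableSpace Ω] (Pr : Measure Ω)
    [IsProbabilityMeasure Pr] (G : ∀ N : ℕ, Ω → Pairing (twoRegular N))
    (hG : ∀ N : ℕ, HasLaw (G N) (cmLaw (twoRegular N)) Pr) {β : ℝ} (hβ : 0 ≤ β) (B : ℝ) :
    ∀ᵐ ω ∂Pr, Tendsto (fun N : ℕ => susceptibility (edges (G N ω)) β B) atTop (𝓝 (chi β B)) := by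
  obtain ⟨δ, -, C, -, h⟩ := exists_gibbs_bounds hβ B
  filter_upwards [ae_tendsto_numCycles_div Pr G hG] with ω hω
  have hlim := hω.const_mul C
  rw [mul_zero] at hlim
  simp only [susceptibility_eq]
  refine tendsto_div_of_abs_sub_le
    (Eventually.of_forall fun N => (h (isCycleUnion_edges (G N ω))).2.2.1) ?_
  simpa only [mul_div_assoc] using hlim

/-! ## The central limit theorem -/

/-- The remainder has derivative `o(|z - c|)`, by differentiability of `f'` at `c`; the mean value
inequality on the ball of radius `‖z - c‖` gains the second factor. -/
lemma isLittleO_sub_taylor_two {f f' : ℂ → ℂ} {f'' c : ℂ}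
    (hf : ∀ᶠ z in 𝓝 c, HasDerivAt f (f' z) z) (hf' : HasDerivAt f' f'' c) :
    (fun z => f z - f c - (z - c) * f' c - (z - c) ^ 2 / 2 * f'') =o[𝓝 c] fun z => (z - c) ^ 2 := by
  rw [Asymptotics.isLittleO_iff]
  intro ε hε
  have h1 := (hasDerivAt_iff_isLittleO.1 hf').def hε
  obtain ⟨δ, hδ, h⟩ := Metric.eventually_nhds_iff_ball.1 (hf.and h1)
  filter_upwards [Metric.ball_mem_nhds c hδ] with z hz
  set g : ℂ → ℂ := fun z => f z - f c - (z - c) * f' c - (z - c) ^ 2 / 2 * f'' with hg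
  have hsub : ∀ y ∈ Metric.closedBall c ‖z - c‖, y ∈ Metric.ball c δ := fun y hy => by
    rw [Metric.mem_ball, dist_eq_norm] at hz
    rw [Metric.mem_ball]
    exact (Metric.mem_closedBall.1 hy).trans_lt hz
  have hgd : ∀ y ∈ Metric.closedBall c ‖z - c‖,
      HasDerivWithinAt g (f' y - f' c - (y - c) • f'') (Metric.closedBall c ‖z - c‖) y :=
    fun y hy => by
      have h2 := ((((h y (hsub y hy)).1.sub_const (f c)).sub
        (((hasDerivAt_id y).sub_const c).mul_const (f' c))).sub
        (((((hasDerivAt_id y).sub_const c).pow 2).div_const 2).mul_const f'')).hasDerivWithinAt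
          (s := Metric.closedBall c ‖z - c‖)
      refine h2.congr_deriv ?_
      simp
  have hbd : ∀ y ∈ Metric.closedBall c ‖z - c‖,
      ‖f' y - f' c - (y - c) • f''‖ ≤ ε * ‖z - c‖ := fun y hy =>
    ((h y (hsub y hy)).2).trans (by
      gcongr
      rw [← dist_eq_norm]
      exact Metric.mem_closedBall.1 hy)
  have h3 := (convex_closedBall c ‖z - c‖).norm_image_sub_le_of_norm_hasDerivWithin_le hgd hbd
    (Metric.mem_closedBall_self (norm_nonneg _))
    (show z ∈ Metric.closedBall c ‖z - c‖ by rw [Metric.mem_closedBall, dist_eq_norm])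
  have h4 : g c = 0 := by simp [hg]
  rw [h4, sub_zero] at h3
  refine h3.trans (le_of_eq ?_)
  rw [norm_pow]
  ring

lemma tendsto_div_sqrt (t : ℝ) : Tendsto (fun N : ℕ => t / √(N : ℝ)) atTop (𝓝 0) :=
  tendsto_const_nhds.div_atTop (Real.tendsto_sqrt_atTop.comp tendsto_natCast_atTop_atTop)

lemma tendsto_complexPressure_sub (β B t : ℝ) :
    Tendsto (fun N : ℕ => (N : ℂ) * (complexPressure β (B + ((t / √(N : ℝ) : ℝ) : ℂ) * Complex.I) -
      complexPressure β B) - ((t / √(N : ℝ) : ℝ) : ℂ) * Complex.I * (N * magnetization β B)) atTop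
      (𝓝 (-(chi β B * t ^ 2 / 2))) := by
  have hd := disc_mem_slitPlane β B
  have hp := eigenPlus_mem_slitPlane β B
  have h0 : ∀ᶠ z in 𝓝 (B : ℂ),
      HasDerivAt (complexPressure β) (Complex.sinh z / discRoot β z) z := by
    filter_upwards [(hasDerivAt_disc β B).continuousAt.eventually
      (Complex.isOpen_slitPlane.mem_nhds hd), (hasDerivAt_eigenPlus hd).continuousAt.eventually
      (Complex.isOpen_slitPlane.mem_nhds hp)] with z h1 h2
    exact hasDerivAt_complexPressure h1 h2
  have h1 := isLittleO_sub_taylor_two h0 (hasDerivAt_sinh_div_discRoot hd)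
  rw [← chi_ofReal, ← magnetization_ofReal] at h1
  let zN : ℕ → ℂ := fun N => B + ((t / √(N : ℝ) : ℝ) : ℂ) * Complex.I
  have hz : Tendsto zN atTop (𝓝 (B : ℂ)) := by
    have := ((Complex.continuous_ofReal.tendsto 0).comp (tendsto_div_sqrt t)).mul_const Complex.I
      |>.const_add (B : ℂ)
    simpa [zN] using this
  have h2 := (h1.comp_tendsto hz).tendsto_div_nhds_zero
  -- The factor is `N (zN - B)² = -t²`, which turns the relative Taylor error into `N` times the
  -- error.
  have h3 := h2.mul_const (-(t : ℂ) ^ 2)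
  have h4 := h3.add_const (-(chi β B * t ^ 2 / 2 : ℂ))
  rw [zero_mul, zero_add] at h4
  -- For `t = 0` the quotient by `(zN - B)²` carries no information.
  rcases eq_or_ne t 0 with rfl | ht
  · simp
  refine h4.congr' ?_
  filter_upwards [eventually_gt_atTop 0] with N hN
  have hN0 : (0 : ℝ) < N := Nat.cast_pos.2 hN
  have hs : (√(N : ℝ) : ℂ) ^ 2 = N := by
    rw [← Complex.ofReal_pow, Real.sq_sqrt hN0.le, Complex.ofReal_natCast]
  have hs0 : (√(N : ℝ) : ℂ) ≠ 0 := Complex.ofReal_ne_zero.2 (Real.sqrt_pos.2 hN0).ne'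
  have ht' : (t : ℂ) ≠ 0 := Complex.ofReal_ne_zero.2 ht
  have hsq : (zN N - B) ^ 2 = -((t : ℂ) ^ 2 / N) := by
    simp only [zN, add_sub_cancel_left, mul_pow, Complex.I_sq]
    push_cast
    rw [div_pow, hs]
    ring
  have hN' : (N : ℂ) ≠ 0 := Nat.cast_ne_zero.2 hN.ne'
  simp only [Function.comp_apply]
  rw [hsq]
  have : zN N - B = ((t / √(N : ℝ) : ℝ) : ℂ) * Complex.I := by simp [zN]
  rw [this]
  change _ = (N : ℂ) * (complexPressure β (zN N) - complexPressure β B) - _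
  field_simp
  ring

/-- Combine `‖exp D - 1‖ ≤ exp ‖D‖ - 1` with the Jensen bound for `p = a / log 3`, whence the
restriction on `a`. -/
lemma norm_integral_exp_sub_one_le {N : ℕ} {a : ℝ} (ha0 : 0 ≤ a) (ha1 : a / Real.log 3 ≤ 1)
    {D : Pairing (twoRegular N) → ℂ} (hD : ∀ π, ‖D π‖ ≤ a * numCycles π) :
    ‖(∫ π, Complex.exp (D π) ∂(cmLaw (twoRegular N))) - 1‖ ≤
      Real.exp (a / Real.log 3 * Real.log (2 * N + 1)) - 1 := by
  have h3 : 0 < Real.log 3 := Real.log_pos (by norm_num)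
  have h1 : (∫ π, Complex.exp (D π) ∂(cmLaw (twoRegular N))) - 1 =
      ∫ π, (Complex.exp (D π) - 1) ∂(cmLaw (twoRegular N)) := by
    rw [integral_sub Integrable.of_finite Integrable.of_finite]
    simp
  have h2 : ∀ π, ‖Complex.exp (D π) - 1‖ ≤
      Real.exp (a / Real.log 3 * Real.log 3 * numCycles π) - 1 := fun π => by
    have := Complex.norm_exp_sub_sum_le_exp_norm_sub_sum (D π) 1
    simp only [Finset.sum_range_one, pow_zero, Nat.factorial_zero, Nat.cast_one, div_one] at this
    refine this.trans (sub_le_sub_right (Real.exp_le_exp.2 ?_) _)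
    rw [div_mul_cancel₀ _ h3.ne']
    exact hD π
  rw [h1]
  refine (norm_integral_le_integral_norm _).trans
    ((integral_mono Integrable.of_finite Integrable.of_finite h2).trans ?_)
  rw [integral_sub Integrable.of_finite Integrable.of_finite]
  have := integral_exp_numCycles_le N (div_nonneg ha0 h3.le) ha1
  simpa using this

lemma integral_avgMeasure {N : ℕ} {F : Type*} [NormedAddCommGroup F] [NormedSpace ℝ F]
    [CompleteSpace F] (β B : ℝ) (f : Config N → F) :
    ∫ σ, f σ ∂(avgMeasure (twoRegular N) β B) =
      ∫ π, ∑ σ, gibbsProb (edges π) β B σ • f σ ∂(cmLaw (twoRegular N)) := by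
  rw [avgMeasure, integral_sum_dirac (p := avgProb (twoRegular N) β B)
      fun σ => integral_nonneg fun π => gibbsProb_nonneg _ β B σ,
    integral_finsetSum _ fun σ _ => Integrable.of_finite]
  refine Finset.sum_congr rfl fun σ _ => ?_
  rw [integral_smul_const, avgProb]

/-- The expectation of the total spin under the averaged quenched measure. -/
noncomputable def avgSpin (N : ℕ) (β B : ℝ) : ℝ :=
  ∫ τ, totalSpin τ ∂(avgMeasure (twoRegular N) β B)

/-- Averaging over graphs leaves an error `O(log N) = o(√N)`, so centering at the averaged mean or
at `N` times the magnetization is equivalent. -/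
lemma abs_avgSpin_sub_le {N : ℕ} {β B C : ℝ} (hC : 0 ≤ C)
    (h : ∀ π : Pairing (twoRegular N),
      |gibbsMoment (edges π) β B 1 - N * magnetization β B| ≤ C * numCycles π) :
    |avgSpin N β B - N * magnetization β B| ≤ C * (Real.log (2 * N + 1) / Real.log 3) := by
  have h1 : avgSpin N β B - N * magnetization β B =
      ∫ π, (gibbsMoment (edges π) β B 1 - N * magnetization β B) ∂(cmLaw (twoRegular N)) := by
    rw [integral_sub Integrable.of_finite Integrable.of_finite, avgSpin, integral_avgMeasure]
    simp [gibbsMoment]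
  rw [h1, ← Real.norm_eq_abs]
  refine (norm_integral_le_integral_norm _).trans
    ((integral_mono Integrable.of_finite Integrable.of_finite h).trans ?_)
  rw [integral_const_mul]
  exact mul_le_mul_of_nonneg_left (integral_numCycles_le N) hC

/-- The normalized total spin. -/
noncomputable def normSpin (N : ℕ) (β B : ℝ) (σ : Config N) : ℝ :=
  (totalSpin σ - avgSpin N β B) / √(N : ℝ)

lemma charFun_normSpin (N : ℕ) (β B t : ℝ) :
    charFun ((avgMeasure (twoRegular N) β B).map (normSpin N β B)) t =
      Complex.exp (-(((t / √(N : ℝ) : ℝ) : ℂ) * Complex.I * avgSpin N β B)) *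
      ∫ π, ∑ σ, (gibbsProb (edges π) β B σ : ℂ) *
        Complex.exp (((t / √(N : ℝ) : ℝ) : ℂ) * totalSpin σ * Complex.I)
        ∂(cmLaw (twoRegular N)) := by
  rw [charFun_apply_real, integral_map (measurable_of_finite _).aemeasurable
    (by fun_prop), integral_avgMeasure, ← integral_const_mul]
  refine integral_congr_ae (Eventually.of_forall fun π => ?_)
  simp only [Finset.mul_sum]
  refine Finset.sum_congr rfl fun σ _ => ?_
  rw [Complex.real_smul, mul_left_comm, ← Complex.exp_add, normSpin]
  congr 2
  push_cast
  ring

/-- The exponential of the pressure increment comes out of the graph average because it is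
deterministic. Three limits remain: the Taylor limit, the centering error, and the average of `exp
D`. -/
lemma tendsto_charFun_normSpin {β : ℝ} (hβ : 0 ≤ β) (B t : ℝ) :
    Tendsto (fun N : ℕ => charFun ((avgMeasure (twoRegular N) β B).map (normSpin N β B)) t) atTop
      (𝓝 (Complex.exp (-(chi β B * t ^ 2 / 2)))) := by
  obtain ⟨δ, hδ, C, hC, h⟩ := exists_gibbs_bounds hβ B
  have h3 : 0 < Real.log 3 := Real.log_pos (by norm_num)
  let s : ℕ → ℝ := fun N => t / √(N : ℝ)
  have hs : Tendsto s atTop (𝓝 0) := tendsto_div_sqrt t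
  have hsabs : Tendsto (fun N => |s N|) atTop (𝓝 0) := by simpa using hs.abs
  have hslog : Tendsto (fun N => C * |s N| / Real.log 3 * Real.log (2 * N + 1)) atTop (𝓝 0) := by
    have := tendsto_log_two_mul_add_one_div_sqrt.const_mul (C * |t| / Real.log 3)
    rw [mul_zero] at this
    refine this.congr fun N => ?_
    simp only [s, abs_div, abs_of_nonneg (Real.sqrt_nonneg _)]
    ring
  choose D hD hDe using fun (N : ℕ) (hN : |s N| < δ) (π : Pairing (twoRegular N)) =>
    (h (isCycleUnion_edges π)).2.2.2 (s N) hN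
  have hev : ∀ᶠ N in atTop, |s N| < δ := hsabs.eventually (gt_mem_nhds hδ)
  -- Outside the range `|s N| < δ`, left only for large `N`, the value 0 keeps the bound on `D'`
  -- valid for all `N`.
  let D' : ∀ N, Pairing (twoRegular N) → ℂ := fun N π => if hN : |s N| < δ then D N hN π else 0
  have hD' : ∀ N π, ‖D' N π‖ ≤ C * |s N| * numCycles π := fun N π => by
    simp only [D']
    split_ifs with hN
    · exact (hD N hN π).trans (le_of_eq (by ring))
    · rw [norm_zero]; positivity
  -- the contribution of the cycles
  have hlim1 : Tendsto (fun N => ∫ π, Complex.exp (D' N π) ∂(cmLaw (twoRegular N))) atTop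
      (𝓝 1) := by
    rw [tendsto_iff_norm_sub_tendsto_zero]
    have hup : Tendsto (fun N : ℕ => Real.exp (C * |s N| / Real.log 3 * Real.log (2 * N + 1)) - 1)
        atTop (𝓝 0) := by
      simpa using ((Real.continuous_exp.tendsto 0).comp hslog).sub_const 1
    refine squeeze_zero' (Eventually.of_forall fun _ => norm_nonneg _) ?_ hup
    have hsmall : Tendsto (fun N => C * |s N| / Real.log 3) atTop (𝓝 0) := by
      simpa using (hsabs.const_mul C).div_const (Real.log 3)
    filter_upwards [hsmall.eventually (ge_mem_nhds one_pos)] with N hN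
    exact norm_integral_exp_sub_one_le (by positivity) hN (hD' N)
  -- the contribution of the mean
  have hlim2 : Tendsto (fun N : ℕ =>
      (s N : ℂ) * Complex.I * (avgSpin N β B - N * magnetization β B)) atTop (𝓝 0) := by
    rw [tendsto_zero_iff_norm_tendsto_zero]
    refine squeeze_zero (fun _ => norm_nonneg _) (fun N => ?_) hslog
    have h1 := abs_avgSpin_sub_le (N := N) hC fun π => (h (isCycleUnion_edges π)).2.1
    rw [norm_mul, norm_mul, Complex.norm_I, mul_one, Complex.norm_real, Real.norm_eq_abs]
    have h2 : ‖(avgSpin N β B - N * magnetization β B : ℂ)‖ =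
        |avgSpin N β B - N * magnetization β B| := by
      rw [← Real.norm_eq_abs, ← Complex.norm_real]
      push_cast
      rfl
    rw [h2]
    exact (mul_le_mul_of_nonneg_left h1 (abs_nonneg _)).trans (le_of_eq (by ring))
  have hlim3 := ((tendsto_complexPressure_sub β B t).sub hlim2).cexp.mul hlim1
  rw [sub_zero, mul_one] at hlim3
  refine hlim3.congr' ?_
  filter_upwards [hev] with N hN
  have hint : ∫ π, ∑ σ, (gibbsProb (edges π) β B σ : ℂ) *
      Complex.exp (s N * totalSpin σ * Complex.I) ∂(cmLaw (twoRegular N)) =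
      Complex.exp (N * (complexPressure β (B + s N * Complex.I) - complexPressure β B)) *
        ∫ π, Complex.exp (D' N π) ∂(cmLaw (twoRegular N)) := by
    rw [← integral_const_mul]
    refine integral_congr_ae (Eventually.of_forall fun π => ?_)
    simp only [D', dif_pos hN]
    rw [← Complex.exp_add]
    exact hDe N hN π
  rw [charFun_normSpin, hint]
  refine Eq.trans ?_ (mul_assoc _ _ _)
  rw [← Complex.exp_add]
  congr 2
  simp only [s]
  ring

lemma tendstoInDistribution_normSpin {β : ℝ} (hβ : 0 ≤ β) (B : ℝ) :
    TendstoInDistribution (fun N : ℕ => normSpin N β B) atTop (id : ℝ → ℝ)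
      (fun N : ℕ => avgMeasure (twoRegular N) β B) (gaussianReal 0 (chi β B).toNNReal) where
  forall_aemeasurable _ := (measurable_of_finite _).aemeasurable
  tendsto := by
    refine ProbabilityMeasure.tendsto_iff_tendsto_charFun.2 fun t => ?_
    have h := tendsto_charFun_normSpin hβ B t
    simp only [ProbabilityMeasure.coe_mk, Measure.map_id, charFun_gaussianReal]
    simpa [Real.coe_toNNReal _ (chi_pos β B).le] using h

end IsingCM

theorem mainTheorem3 {Ω : Type*} [MeasurableSpace Ω] (Pr : Measure Ω) [IsProbabilityMeasure Pr]
    (G : ∀ N : ℕ, Ω → IsingCM.Pairing (IsingCM.twoRegular N))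
    (hG : ∀ N : ℕ, HasLaw (G N) (IsingCM.cmLaw (IsingCM.twoRegular N)) Pr)
    (β B : ℝ) (hβ : 0 ≤ β) :
    -- the pressures of the one-dimensional Ising model (periodic and free) and of the random graphs
    Tendsto (fun N : ℕ => IsingCM.pressure (IsingCM.cycleEdges N) β B) atTop
      (𝓝 (IsingCM.pressureOneDim β B)) ∧
    Tendsto (fun N : ℕ => IsingCM.pressure (IsingCM.pathEdges N) β B) atTop
      (𝓝 (IsingCM.pressureOneDim β B)) ∧
    (∀ᵐ ω ∂Pr, Tendsto (fun N : ℕ => IsingCM.pressure (IsingCM.edges (G N ω)) β B) atTop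
      (𝓝 (IsingCM.pressureOneDim β B))) ∧
    ∃ χ : ℝ, 0 < χ ∧
      -- `χ` is the limit of the random quenched susceptibilities
      (∀ᵐ ω ∂Pr, Tendsto (fun N : ℕ => IsingCM.susceptibility (IsingCM.edges (G N ω)) β B) atTop
        (𝓝 χ)) ∧
      -- the central limit theorem with respect to the averaged quenched measure
      TendstoInDistribution
        (fun (N : ℕ) (σ : IsingCM.Config N) =>
          (IsingCM.totalSpin σ -
            ∫ τ, IsingCM.totalSpin τ ∂(IsingCM.avgMeasure (IsingCM.twoRegular N) β B)) /
            √(N : ℝ))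
        atTop (id : ℝ → ℝ)
        (fun N : ℕ => IsingCM.avgMeasure (IsingCM.twoRegular N) β B)
        (gaussianReal 0 χ.toNNReal) ∧
      -- identification with the one-dimensional susceptibility
      χ = IsingCM.susceptibilityOneDim β B ∧
      χ = Real.cosh B * Real.exp (-4 * β) /
        (Real.sinh B ^ 2 + Real.exp (-4 * β)) ^ (3 / 2 : ℝ) :=
  ⟨IsingCM.tendsto_pressure_cycleEdges hβ B, IsingCM.tendsto_pressure_pathEdges hβ B,
    IsingCM.ae_tendsto_pressure Pr G hG hβ B, IsingCM.chi β B, IsingCM.chi_pos β B,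
    IsingCM.ae_tendsto_susceptibility Pr G hG hβ B, IsingCM.tendstoInDistribution_normSpin hβ B,
    (IsingCM.susceptibilityOneDim_eq_chi β B).symm, rfl⟩
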